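/- **Setting.** Let $\mathsf X$ be a measurable space with countably generated $\sigma$-field, $\Theta$ a measurable space, $\pi$ a probability measure on $\mathsf X$, and $\{P_\theta,\theta\in\Theta\}$ a family of Markov kernels on $\mathsf X$ such that $(\theta,x)\mapsto P_\theta(x,A)$ is measurable for every measurable $A$. Write $P_\theta f(x)=\int P_\theta(x,dy)f(y)$ and $\pi(f)=\int f\,d\pi$. Let $\{(X_n,\theta_n),n\ge 0\}$ be an $\mathsf X\times\Theta$-valued process on a probability space, with initial law $\bar\mu$ and natural filtration $\mathcal F_n$, such that $\mathbb E(f(X_{n+1})\mid\mathcal F_n)=P_{\theta_n}f(X_n)$ a.s. for all $n\ge0$ and all measurable $f\ge 0$. For $W:\mathsf X\to[1,\infty)$ let $|f|_W=\sup_x|f(x)|/W(x)$, let $\mathcal L_W$ be the set of measurable $f:\mathsf X\to\mathbb R$ with $|f|_W<\infty$, and let $\|\mu\|_W=\sup\{|\mu(f)|: f\text{ measurable},\ |f|_W\le 1\}$ for a signed measure $\mu$. **Assumptions.** A1: Each $P_\theta$ is phi-irreducible and aperiodic with invariant distribution $\pi$. There is a measurable $V:\mathsf X\to[1,\infty)$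 with $\int V(x)\,\bar\mu(dx,d\theta)<\infty$ such that for every $\beta\in(0,1]$ there are $\rho\in(0,1)$ and $C\in(0,\infty)$ with $\|P_\theta^n(x,\cdot)-\pi\|_{V^\beta}\le C\rho^nV^\beta(x)$ for all $(x,\theta)$ and all $n\ge0$. Furthermore there are $b\in(0,\infty)$ and $\lambda\in(0,1)$ with $P_\theta V(x)\le\lambda V(x)+b$ for all $(x,\theta)$. A2: There are $\eta\in[0,1/2)$ and a nonincreasing sequence of positive numbers $\{\gamma_n,n\ge1\}$ with $\gamma_n=O(n^{-\alpha})$ for some $\alpha>1/2$, such that for every $\beta\in[0,1]$ there is a finite constant $C$ with $D_\beta(\theta_{n-1},\theta_n)\le C\gamma_nV^\eta(X_n)$ a.s. for all $n\ge1$, where $$D_\beta(\theta,\theta')=\sup_{|f|_{V^\beta}\le1}\ \sup_{x\in\mathsf X}\frac{|P_\theta f(x)-P_{\theta'}f(x)|}{V^\beta(x)},$$ the first supremum being over measurable $f$. A3: The function $w:\mathbb R\to\mathbb R$ satisfies $w(x)=0$ for $|x|\ge1$, is even, has $w(0)=1$, and its restriction to $[0,1]$ is twice continuously differentiable (one-sided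 at the endpoints). **Notation.** For $h\in\mathcal L_{V^\beta}$ let $\bar P_\theta=P_\theta-\pi$, i.e. $\bar P_\theta f(x)=P_\theta f(x)-\pi(f)$, and $$g_\theta(x)=\sum_{j\ge0}\bar P_\theta^jh(x),\qquad G_\theta(x,y)=g_\theta(y)-P_\theta g_\theta(x).$$ Let $\pi_n(h)=n^{-1}\sum_{k=1}^nh(X_k)$, let $\gamma_n(k)=n^{-1}\sum_{j=1}^{n-k}(h(X_j)-\pi_n(h))(h(X_{j+k})-\pi_n(h))$ for $0\le k<n$, $\gamma_n(-k)=\gamma_n(k)$, $\gamma_n(k)=0$ for $|k|\ge n$ (these autocovariances are not the sequence $\gamma_n$ of A2), and $\Gamma_n^2(h)=\sum_{k=-n}^{n}w(kb_n)\gamma_n(k)$. **Theorem 4.2.** Assume A1–A3 with $\eta<1/4$, where $\eta$ is as in A2. Let $\beta\in(0,1/4-\eta)$ and $h\in\mathcal L_{V^\beta}$. Suppose that $b_n=c\,n^{-\delta}$ for all $n\ge1$, where $c>0$ and $\delta\in(2(\beta+\eta),1/2)$. Then, for all $\theta$ and $x$, the series defining $g_\theta(x)$ converges absolutely and $g_\theta$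 is $P_\theta(x,\cdot)$-integrable, and $$\lim_{n\to\infty}\Bigl(\Gamma_n^2(h)-\frac1n\sum_{k=1}^nG^2_{\theta_{k-1}}(X_{k-1},X_k)\Bigr)=0\qquad\text{almost surely.}$$ -/

import Mathlib

open MeasureTheory ProbabilityTheory Filter
open scoped ENNReal Topology

namespace AdaptiveMCMC

noncomputable section

/-! ### Weighted norms -/

/-- The `W`-norm `|f|_W = sup_x |f x| / W x` of a function, with values in `[0, ∞]`.
It is used only for weights `W ≥ 1`. -/
def wNorm {X : Type*} (W f : X → ℝ) : ℝ≥0∞ :=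
  ⨆ x, ENNReal.ofReal (|f x| / W x)

/-- The set `𝓛_W` of measurable functions of finite `W`-norm. -/
def LSpace {X : Type*} [MeasurableSpace X] (W : X → ℝ) : Set (X → ℝ) :=
  {f | Measurable f ∧ wNorm W f < ∞}

/-- The `W`-norm `‖μ - ν‖_W = sup { |μ(f) - ν(f)| : f measurable, |f|_W ≤ 1 }` of the difference
of two measures, with values in `[0, ∞]`. -/
def measNorm {X : Type*} [MeasurableSpace X] (W : X → ℝ) (μ ν : Measure X) : ℝ≥0∞ :=
  ⨆ (f : X → ℝ) (_ : Measurable f) (_ : wNorm W f ≤ 1),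
    ENNReal.ofReal |∫ y, f y ∂μ - ∫ y, f y ∂ν|

/-- `D_β(θ, θ') = sup_{|f|_{V^β} ≤ 1} sup_x |P_θ f(x) - P_θ' f(x)| / V(x)^β`,
with values in `[0, ∞]`. -/
def kerDist {X Θ : Type*} [MeasurableSpace X] (P : Θ → Kernel X X) (V : X → ℝ) (β : ℝ)
    (t t' : Θ) : ℝ≥0∞ :=
  ⨆ (f : X → ℝ) (_ : Measurable f) (_ : wNorm (fun x => V x ^ β) f ≤ 1) (x : X),
    ENNReal.ofReal (|∫ y, f y ∂(P t x) - ∫ y, f y ∂(P t' x)| / V x ^ β)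

/-! ### Irreducibility and aperiodicity -/

/-- A kernel is phi-irreducible if it is `φ`-irreducible for some nonzero σ-finite `φ`. -/
def PhiIrreducible {X : Type*} [MeasurableSpace X] (κ : Kernel X X) : Prop :=
  ∃ φ : Measure X, SigmaFinite φ ∧ φ ≠ 0 ∧ Kernel.IsIrreducible φ κ

/-- `D₀, …, D_{d-1}` is a `d`-cycle of `κ`, up to a `φ`-null set: the sets are measurable and
disjoint, `κ` moves each `D_i` into `D_{i+1}` (indices mod `d`), and their union is `φ`-full. -/
structure IsCycle {X : Type*} [MeasurableSpace X] (κ : Kernel X X) (φ : Measure X) (d : ℕ)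
    (D : ZMod d → Set X) : Prop where
  measurableSet : ∀ i, MeasurableSet (D i)
  disjoint : Pairwise fun i j => Disjoint (D i) (D j)
  step : ∀ i, ∀ x ∈ D i, κ x (D (i + 1)) = 1
  full : φ (⋃ i, D i)ᶜ = 0

/-- A phi-irreducible kernel is aperiodic if it has no `d`-cycle with `d ≥ 2`. The union of a
cycle is absorbing, so that it is full for one irreducibility measure if and only if it is full for
every irreducibility measure (in particular for a maximal one). -/
def Aperiodic {X : Type*} [MeasurableSpace X] (κ : Kernel X X) : Prop :=
  ∀ φ : Measure X, SigmaFinite φ → φ ≠ 0 → Kernel.IsIrreducible φ κ →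
    ∀ d : ℕ, 2 ≤ d → ∀ D : ZMod d → Set X, ¬ IsCycle κ φ d D

/-! ### Adaptive Markov chains -/

/-- The natural filtration `𝓕_n = σ((X_k, θ_k), k ≤ n)`. -/
@[reducible] def natFiltration {Ω X Θ : Type*} [MeasurableSpace X] [MeasurableSpace Θ]
    (ξ : ℕ → Ω → X) (θ : ℕ → Ω → Θ) (n : ℕ) : MeasurableSpace Ω :=
  ⨆ k ≤ n, MeasurableSpace.comap (fun ω => (ξ k ω, θ k ω)) inferInstance

/-- The process `(X_n, θ_n) = (ξ n, θ n)` under `ℙ = μ` has initial law `μ₀`, and `ξ` is an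
adaptive Markov chain driven by the kernels `P_θ`:
`𝔼[f(X_{n+1}) | 𝓕_n] = P_{θ_n} f(X_n)` a.s. for all measurable `f ≥ 0`.
The conditional law of `θ_{n+1}` is not restricted. -/
structure IsAdaptiveChain {Ω X Θ : Type*} [MeasurableSpace Ω] [MeasurableSpace X]
    [MeasurableSpace Θ] (μ : Measure Ω) (μ₀ : Measure (X × Θ)) (P : Θ → Kernel X X)
    (ξ : ℕ → Ω → X) (θ : ℕ → Ω → Θ) : Prop where
  measurable_state : ∀ n, Measurable (ξ n)
  measurable_param : ∀ n, Measurable (θ n)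
  initial : μ.map (fun ω => (ξ 0 ω, θ 0 ω)) = μ₀
  transition : ∀ n : ℕ, ∀ f : X → ℝ≥0∞, Measurable f →
    μ⁻[fun ω => f (ξ (n + 1) ω) | natFiltration ξ θ n]
      =ᵐ[μ] fun ω => ∫⁻ y, f y ∂(P (θ n ω) (ξ n ω))

/-! ### The assumptions -/

/-- Geometric ergodicity, uniformly in the parameter, with drift function `V`. -/
structure AssumptionA1 {X Θ : Type*} [MeasurableSpace X] [MeasurableSpace Θ]
    (P : Θ → Kernel X X) (π : Measure X) (μ₀ : Measure (X × Θ)) (V : X → ℝ) : Prop where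
  irreducible : ∀ t, PhiIrreducible (P t)
  aperiodic : ∀ t, Aperiodic (P t)
  invariant : ∀ t, (P t).Invariant π
  measurable_V : Measurable V
  one_le_V : ∀ x, 1 ≤ V x
  integrable_V : Integrable (fun p : X × Θ => V p.1) μ₀
  rate : ∀ β : ℝ, 0 < β → β ≤ 1 → ∃ ρ C : ℝ, 0 < ρ ∧ ρ < 1 ∧ 0 < C ∧
    ∀ (x : X) (t : Θ) (n : ℕ),
      measNorm (fun y => V y ^ β) ((P t ^ n) x) π ≤ ENNReal.ofReal (C * ρ ^ n * V x ^ β)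
  drift : ∃ b lam : ℝ, 0 < b ∧ 0 < lam ∧ lam < 1 ∧
    ∀ (x : X) (t : Θ),
      ∫⁻ y, ENNReal.ofReal (V y) ∂(P t x) ≤ ENNReal.ofReal (lam * V x + b)

/-- Diminishing adaptation, with exponent `η`. -/
def AssumptionA2 {Ω X Θ : Type*} [MeasurableSpace Ω] [MeasurableSpace X]
    (μ : Measure Ω) (P : Θ → Kernel X X) (V : X → ℝ)
    (ξ : ℕ → Ω → X) (θ : ℕ → Ω → Θ) (η : ℝ) : Prop :=
  0 ≤ η ∧ η < 1 / 2 ∧ ∃ γ : ℕ → ℝ,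
    (∀ n, 1 ≤ n → 0 < γ n) ∧ (∀ m n, 1 ≤ m → m ≤ n → γ n ≤ γ m) ∧
    (∃ α : ℝ, 1 / 2 < α ∧ γ =O[atTop] fun n : ℕ => (n : ℝ) ^ (-α)) ∧
    ∀ β : ℝ, 0 ≤ β → β ≤ 1 → ∃ C : ℝ, ∀ n : ℕ, 1 ≤ n → ∀ᵐ ω ∂μ,
      kerDist P V β (θ (n - 1) ω) (θ n ω) ≤ ENNReal.ofReal (C * γ n * V (ξ n ω) ^ η)

/-- The conditions on the lag window `w`. -/
structure AssumptionA3 (w : ℝ → ℝ) : Prop where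
  support : ∀ x, 1 ≤ |x| → w x = 0
  even : ∀ x, w (-x) = w x
  zero : w 0 = 1
  smooth : ContDiffOn ℝ 2 w (Set.Icc 0 1)

/-! ### The resolvent functions -/

/-- The operator `P̄ = κ - π`, that is `P̄ f(x) = κ f(x) - π(f)`. -/
def pbar {X : Type*} [MeasurableSpace X] (κ : Kernel X X) (π : Measure X)
    (f : X → ℝ) : X → ℝ :=
  fun x => ∫ y, f y ∂(κ x) - ∫ y, f y ∂π

/-- `g(x) = ∑_{j ≥ 0} P̄^j h(x)`. -/
def resolvent {X : Type*} [MeasurableSpace X] (κ : Kernel X X) (π : Measure X)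
    (h : X → ℝ) (x : X) : ℝ :=
  ∑' j : ℕ, ((pbar κ π)^[j] h) x

/-- `G(x, y) = g(y) - κ g(x)`. -/
def bigG {X : Type*} [MeasurableSpace X] (κ : Kernel X X) (π : Measure X)
    (h : X → ℝ) (x y : X) : ℝ :=
  resolvent κ π h y - ∫ z, resolvent κ π h z ∂(κ x)

/-! ### The kernel estimator, for a real sequence `Y_1, Y_2, …` -/

/-- The sample mean `n⁻¹ ∑_{k=1}^n Y_k`. -/
def sampleMean (Y : ℕ → ℝ) (n : ℕ) : ℝ :=
  (n : ℝ)⁻¹ * ∑ k ∈ Finset.Icc 1 n, Y k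

/-- The sample autocovariance `γ_n(k)`: zero for `|k| ≥ n`, even in `k`, and
`γ_n(k) = n⁻¹ ∑_{j=1}^{n-k} (Y_j - mean) (Y_{j+k} - mean)` for `0 ≤ k < n`. -/
def sampleAutocov (Y : ℕ → ℝ) (n : ℕ) (k : ℤ) : ℝ :=
  if n ≤ k.natAbs then 0
  else (n : ℝ)⁻¹ * ∑ j ∈ Finset.Icc 1 (n - k.natAbs),
    (Y j - sampleMean Y n) * (Y (j + k.natAbs) - sampleMean Y n)

/-- The estimator `∑_{k=-n}^n w(k b_n) γ_n(k)`. -/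
def kernelEstimator (w : ℝ → ℝ) (b : ℕ → ℝ) (Y : ℕ → ℝ) (n : ℕ) : ℝ :=
  ∑ k ∈ Finset.Icc (-(n : ℤ)) (n : ℤ), w ((k : ℝ) * b n) * sampleAutocov Y n k

end

end AdaptiveMCMC

namespace AdaptiveMCMC

/-! ### The lag window -/

/-! The Poisson equation g_θ - P_θ g_θ = h - π(h) gives, for the centred values Y_j = h(X_j) - π(h),
the decomposition Y_j = D_j + U_{j-1} - U_j + R_j. Here D_j = G_{θ_{j-1}}(X_{j-1}, X_j) is a
martingale difference, U_j = P_{θ_j} g_{θ_j}(X_j), and R_j = g_{θ_j}(X_j) - g_{θ_{j-1}}(X_j) is the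
price of changing the parameter. Since g_θ is Lipschitz in the kernel (`abs_poissonSol_sub_le`), R_j
is O(γ_j V^{β+η}(X_j)). The drift condition bounds the mean of V(X_n), and 4(β+η) < 1, so D, U, Y
are bounded in L⁴ and the L⁴ norms of R are square summable (`exists_martingaleApprox`).

Up to the centring by the sample mean, the estimator is the quadratic form n⁻¹(∑ Y_j² + 2 ∑ Y_j H_j)
with H_j = ∑_{k≥1} w(k b_n) Y_{j-k}. Summation by parts and completion of the square
(`sum_sq_add_sum_mul_eq`) extract n⁻¹ ∑ D_j² and leave terms that must vanish. The terms D_j H_j are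
sums of n^δ martingale transforms, each O(√n) by Doob's inequality, so after division by n they are
O(n^{δ-1/2}). The terms R_j H_j have the same order because ∑_{j≤n} ‖R_j‖ = O(√n). The delicate term
is U_j (H_j + Y_j - H_{j+1}): the increment of H is rewritten with the second differences of the
window, of total size O(n^{-δ}), against oscillations of the partial sums of Y over n^δ steps, of
size O(n^{δ/2}) (`abs_pastSum_increment_le`); the product is O(n^{-δ/2}).

Almost sure convergence comes from bounds on maxima over dyadic blocks N ≤ n < 2N
(`BlockSmall.tendsto`), or from square-summable L² norms for the boundary terms.
`MartingaleApprox.tendsto_kernelEstimator` collects the pieces without reference to Markov chains.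
-/

lemma AssumptionA3.exists_lipschitz {w : ℝ → ℝ} (hw : AssumptionA3 w) :
    ∃ L : ℝ, 0 ≤ L ∧ ∀ x y, 0 ≤ x → x ≤ y → |w x - w y| ≤ L * (y - x) := by
  obtain ⟨L, hL⟩ := hw.smooth.exists_lipschitzOnWith (by norm_num) (convex_Icc 0 1) isCompact_Icc
  have key : ∀ x y, 0 ≤ x → x ≤ y → y ≤ 1 → |w x - w y| ≤ L * (y - x) := by
    intro x y hx hxy hy
    have h := hL.dist_le_mul x ⟨hx, hxy.trans hy⟩ y ⟨hx.trans hxy, hy⟩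
    rwa [Real.dist_eq, Real.dist_eq, abs_sub_comm x y, abs_of_nonneg (sub_nonneg.2 hxy)] at h
  refine ⟨L, L.2, fun x y hx hxy => ?_⟩
  rcases le_total y 1 with hy | hy
  · exact key x y hx hxy hy
  · have hwy : w y = 0 := hw.support y (hy.trans (le_abs_self y))
    have hw1 : w 1 = 0 := hw.support 1 (by simp)
    -- An interval across 1 is cut at 1, where w vanishes, so extending w by zero creates no jump.
    rcases le_total x 1 with hx1 | hx1
    · have h := key x 1 hx hx1 le_rfl
      rw [hw1] at h
      rw [hwy]
      exact h.trans (mul_le_mul_of_nonneg_left (by linarith) L.2)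
    · rw [hwy, hw.support x (hx1.trans (le_abs_self x))]
      simpa using mul_nonneg L.2 (sub_nonneg.2 hxy)

/-- The mean value inequality for y ↦ w(y + b) - w(y): its derivative is at most L b because w' is
Lipschitz on [0,1]. The three nodes must stay in [0,1], since w' may jump at 1. -/
lemma AssumptionA3.exists_second_difference {w : ℝ → ℝ} (hw : AssumptionA3 w) :
    ∃ L : ℝ, 0 ≤ L ∧ ∀ x b, 0 ≤ x → 0 < b → x + b + b ≤ 1 →
      |(w x - w (x + b)) - (w (x + b) - w (x + b + b))| ≤ L * b ^ 2 := by
  have hu : UniqueDiffOn ℝ (Set.Icc (0 : ℝ) 1) := uniqueDiffOn_Icc one_pos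
  have hd : ContDiffOn ℝ 1 (derivWithin w (Set.Icc 0 1)) (Set.Icc 0 1) :=
    hw.smooth.derivWithin hu (by norm_num)
  obtain ⟨L, hL⟩ := hd.exists_lipschitzOnWith (by norm_num) (convex_Icc 0 1) isCompact_Icc
  have hder : ∀ y ∈ Set.Icc (0 : ℝ) 1,
      HasDerivWithinAt w (derivWithin w (Set.Icc 0 1) y) (Set.Icc 0 1) y := fun y hy =>
    ((hw.smooth.differentiableOn (by norm_num)) y hy).hasDerivWithinAt
  refine ⟨L, L.2, fun x b hx hb hxb => ?_⟩
  have hφ : ∀ y ∈ Set.Icc x (x + b), HasDerivWithinAt (fun y => w (y + b) - w y)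
      (derivWithin w (Set.Icc 0 1) (y + b) - derivWithin w (Set.Icc 0 1) y)
      (Set.Icc x (x + b)) y := by
    intro y hy
    refine HasDerivWithinAt.sub ?_ ((hder y ⟨hx.trans hy.1, by linarith [hy.2]⟩).mono ?_)
    · have h1 := hder (y + b) ⟨by linarith [hy.1], by linarith [hy.2]⟩
      have h2 : HasDerivWithinAt (fun y : ℝ => y + b) 1 (Set.Icc x (x + b)) y :=
        ((hasDerivAt_id y).add_const b).hasDerivWithinAt
      have hmaps : Set.MapsTo (fun y : ℝ => y + b) (Set.Icc x (x + b)) (Set.Icc 0 1) :=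
        fun z hz => ⟨by linarith [hz.1], by linarith [hz.2]⟩
      have h3 := h1.comp y h2 hmaps
      rw [mul_one] at h3
      exact h3
    · exact fun z hz => ⟨hx.trans hz.1, by linarith [hz.2]⟩
  have hbound : ∀ y ∈ Set.Icc x (x + b),
      ‖derivWithin w (Set.Icc 0 1) (y + b) - derivWithin w (Set.Icc 0 1) y‖ ≤ L * b := by
    intro y hy
    have h := hL.dist_le_mul (y + b) ⟨by linarith [hy.1], by linarith [hy.2]⟩ y
      ⟨hx.trans hy.1, by linarith [hy.2]⟩
    rw [dist_eq_norm, Real.dist_eq] at h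
    simpa [abs_of_pos hb] using h
  have h := (convex_Icc x (x + b)).norm_image_sub_le_of_norm_hasDerivWithin_le hφ hbound
    (Set.left_mem_Icc.2 (by linarith)) (Set.right_mem_Icc.2 (by linarith))
  rw [Real.norm_eq_abs, Real.norm_eq_abs, add_sub_cancel_left, abs_of_pos hb] at h
  calc _ = |w (x + b + b) - w (x + b) - (w (x + b) - w x)| := by congr 1; ring
    _ ≤ _ := h
    _ = _ := by ring

/-- The window is bounded, and the total variation of the differences of its values on a grid of
mesh `b` is `O(b)`. -/
lemma AssumptionA3.exists_bound {w : ℝ → ℝ} (hw : AssumptionA3 w) :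
    ∃ B : ℝ, 0 < B ∧ (∀ x, |w x| ≤ B) ∧ ∀ b : ℝ, 0 < b →
      ∑ k ∈ Finset.range (⌊1 / b⌋₊ + 2), |(w (k * b) - w ((k + 1 : ℕ) * b))
        - (w ((k + 1 : ℕ) * b) - w ((k + 2 : ℕ) * b))| ≤ B * b := by
  obtain ⟨L, hL0, hL⟩ := hw.exists_lipschitz
  obtain ⟨M, hM0, hM⟩ := hw.exists_second_difference
  refine ⟨1 + L + (M + 6 * L), by positivity, fun x => ?_, fun b hb => ?_⟩
  · have hpos : ∀ x, 0 ≤ x → |w x| ≤ 1 + L := by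
      intro x hx
      rcases le_total x 1 with hx1 | hx1
      · have h := hL 0 x le_rfl hx
        rw [hw.zero, abs_sub_comm] at h
        have h2 : |w x| ≤ |w x - 1| + 1 := by
          simpa using abs_add_le (w x - 1) 1
        nlinarith
      · rw [hw.support x (hx1.trans (le_abs_self x))]
        simp; positivity
    have : |w x| ≤ 1 + L := by
      rcases le_total 0 x with hx | hx
      · exact hpos x hx
      · rw [← hw.even x]; exact hpos _ (by linarith)
    linarith
  · set m := ⌊1 / b⌋₊
    have hmb : m * b ≤ 1 := by
      have := Nat.floor_le (by positivity : 0 ≤ 1 / b)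
      rwa [le_div_iff₀ hb] at this
    -- At most three indices have a node beyond ⌊1/b⌋; there only the Lipschitz bound is available,
    -- which costs O(b) each and does not spoil the total.
    have hterm : ∀ k : ℕ, |(w (k * b) - w ((k + 1 : ℕ) * b))
        - (w ((k + 1 : ℕ) * b) - w ((k + 2 : ℕ) * b))| ≤
        if k < m - 1 then M * b ^ 2 else 2 * L * b := by
      intro k
      split_ifs with hk
      · have h := hM (k * b) b (by positivity) hb (by
          have : ((k + 2 : ℕ) : ℝ) ≤ m := by exact_mod_cast (by omega : k + 2 ≤ m)
          push_cast at this
          nlinarith)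
        convert h using 3 <;> push_cast <;> ring_nf
      · have h1 := hL (k * b) ((k + 1 : ℕ) * b) (by positivity) (by push_cast; nlinarith)
        have h2 := hL ((k + 1 : ℕ) * b) ((k + 2 : ℕ) * b) (by positivity) (by push_cast; nlinarith)
        refine (abs_sub _ _).trans ?_
        push_cast at h1 h2 ⊢
        nlinarith
    have hle : m + 2 ≤ (m - 1) + 3 := by omega
    calc _ ≤ ∑ k ∈ Finset.range (m + 2), if k < m - 1 then M * b ^ 2 else 2 * L * b :=
          Finset.sum_le_sum fun k _ => hterm k
      _ ≤ ∑ k ∈ Finset.range ((m - 1) + 3), if k < m - 1 then M * b ^ 2 else 2 * L * b := by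
          refine Finset.sum_le_sum_of_subset_of_nonneg (Finset.range_mono hle) fun k _ _ => ?_
          split_ifs <;> positivity
      _ = ∑ k ∈ Finset.range (m - 1), M * b ^ 2 + 3 * (2 * L * b) := by
          rw [Finset.sum_range_add]
          congr 1
          · exact Finset.sum_congr rfl fun k hk => if_pos (Finset.mem_range.1 hk)
          · simp
      _ ≤ (M + 6 * L) * b := by
          rw [Finset.sum_const, Finset.card_range, nsmul_eq_mul]
          have h1 : ((m - 1 : ℕ) : ℝ) * b ≤ 1 :=
            le_trans (mul_le_mul_of_nonneg_right (by exact_mod_cast Nat.sub_le m 1) hb.le) hmb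
          have : ((m - 1 : ℕ) : ℝ) * (M * b ^ 2) ≤ M * b := by
            calc _ = (((m - 1 : ℕ) : ℝ) * b) * (M * b) := by ring
              _ ≤ 1 * (M * b) := mul_le_mul_of_nonneg_right h1 (by positivity)
              _ = _ := one_mul _
          linarith
      _ ≤ _ := by nlinarith

lemma AssumptionA3.eq_zero_of_floor_lt {w : ℝ → ℝ} (hw : AssumptionA3 w) {b : ℝ} (hb : 0 < b)
    {k : ℕ} (hk : ⌊1 / b⌋₊ < k) : w (k * b) = 0 := by
  refine hw.support _ (le_trans ?_ (le_abs_self _))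
  have := (Nat.floor_lt (by positivity)).1 hk
  rw [div_lt_iff₀ hb] at this
  exact this.le

/-! ### Algebra of the estimator -/

/-- The weighted sum `∑_{k=1}^K v_k Y_{j-k}` of past values. -/
noncomputable def pastSum (v Y : ℕ → ℝ) (K j : ℕ) : ℝ :=
  ∑ k ∈ Finset.range K, v (k + 1) * Y (j - (k + 1))

/-- The quadratic form `n⁻¹ ∑_{i,j=1}^n v_{|i-j|} Y_i Y_j`, if `Y_0 = 0` and `v_k = 0` for
`k > K`. -/
noncomputable def lagForm (v Y : ℕ → ℝ) (K n : ℕ) : ℝ :=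
  (n : ℝ)⁻¹ * (∑ j ∈ Finset.Icc 1 n, Y j ^ 2 + 2 * ∑ j ∈ Finset.Icc 1 n, Y j * pastSum v Y K j)

/-- Truncated subtraction sends every j ≤ k to the index 0, where Y vanishes, so no boundary terms
appear. -/
lemma sum_mul_shift (Y : ℕ → ℝ) (hY : Y 0 = 0) (n k : ℕ) :
    ∑ j ∈ Finset.Icc 1 n, Y j * Y (j - k) = ∑ j ∈ Finset.Icc 1 (n - k), Y j * Y (j + k) := by
  have h1 : ∑ j ∈ Finset.Icc 1 (n - k), Y j * Y (j + k) =
      ∑ j ∈ (Finset.Icc 1 (n - k)).map (addRightEmbedding k), Y j * Y (j - k) := by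
    rw [Finset.sum_map]
    refine Finset.sum_congr rfl fun j _ => ?_
    simp [mul_comm]
  rw [h1]
  symm
  refine Finset.sum_subset ?_ ?_
  · intro j hj
    simp only [Finset.mem_map, Finset.mem_Icc, addRightEmbedding_apply] at hj ⊢
    omega
  · intro j hj hj'
    simp only [Finset.mem_map, Finset.mem_Icc, addRightEmbedding_apply, not_exists, not_and]
      at hj hj'
    have : j - k = 0 := by
      by_contra hne
      exact hj' (j - k) (by omega) (by omega)
    rw [this, hY, mul_zero]

/-- Expanding the centred product leaves three terms containing the mean m. The one with m² is no
worse than the others because n|m| ≤ ∑ |Y_j|. -/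
lemma abs_sampleAutocov_sub_le (Y : ℕ → ℝ) (hY : Y 0 = 0) {n : ℕ} (hn : 1 ≤ n) (k : ℕ) :
    |sampleAutocov Y n k - (n : ℝ)⁻¹ * ∑ j ∈ Finset.Icc 1 n, Y j * Y (j - k)| ≤
      3 * |sampleMean Y n| * ((n : ℝ)⁻¹ * ∑ j ∈ Finset.Icc 1 n, |Y j|) := by
  have hn0 : (0 : ℝ) < n := by exact_mod_cast hn
  rw [sum_mul_shift Y hY]
  unfold sampleAutocov
  simp only [Int.natAbs_natCast]
  split_ifs with hk
  · rw [Nat.sub_eq_zero_of_le hk]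
    simp only [Finset.Icc_eq_empty_of_lt (zero_lt_one), Finset.sum_empty, mul_zero, sub_self,
      abs_zero]
    positivity
  · set m := sampleMean Y n with hm
    set A := ∑ j ∈ Finset.Icc 1 n, |Y j| with hA
    have hmA : n * |m| ≤ A := by
      rw [hm, sampleMean, abs_mul, abs_of_pos (inv_pos.2 hn0), ← mul_assoc,
        mul_inv_cancel₀ hn0.ne', one_mul]
      exact Finset.abs_sum_le_sum_abs _ _
    have h1 : ∑ j ∈ Finset.Icc 1 (n - k), |Y j| ≤ A :=
      Finset.sum_le_sum_of_subset_of_nonneg (Finset.Icc_subset_Icc le_rfl (Nat.sub_le n k))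
        fun _ _ _ => abs_nonneg _
    have h2 : ∑ j ∈ Finset.Icc 1 (n - k), |Y (j + k)| ≤ A := by
      have : ∑ j ∈ Finset.Icc 1 (n - k), |Y (j + k)| =
          ∑ j ∈ (Finset.Icc 1 (n - k)).map (addRightEmbedding k), |Y j| := by
        rw [Finset.sum_map]; rfl
      rw [this]
      refine Finset.sum_le_sum_of_subset_of_nonneg ?_ fun _ _ _ => abs_nonneg _
      intro j hj
      simp only [Finset.mem_map, Finset.mem_Icc, addRightEmbedding_apply] at hj ⊢
      omega
    have h3 : ∑ _j ∈ Finset.Icc 1 (n - k), |m| * |m| ≤ |m| * A := by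
      rw [Finset.sum_const, Nat.card_Icc, nsmul_eq_mul, Nat.add_sub_cancel]
      have h4 : ((n - k : ℕ) : ℝ) ≤ n := by exact_mod_cast Nat.sub_le n k
      have h5 : ((n - k : ℕ) : ℝ) * |m| ≤ A :=
        (mul_le_mul_of_nonneg_right h4 (abs_nonneg m)).trans hmA
      nlinarith [abs_nonneg m]
    rw [← mul_sub, ← Finset.sum_sub_distrib, abs_mul, abs_of_pos (inv_pos.2 hn0)]
    have h6 : |∑ j ∈ Finset.Icc 1 (n - k), ((Y j - m) * (Y (j + k) - m) - Y j * Y (j + k))| ≤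
        3 * |m| * A := by
      calc _ ≤ ∑ j ∈ Finset.Icc 1 (n - k), (|m| * |Y j| + |m| * |Y (j + k)| + |m| * |m|) := by
            refine (Finset.abs_sum_le_sum_abs _ _).trans (Finset.sum_le_sum fun j _ => ?_)
            have : (Y j - m) * (Y (j + k) - m) - Y j * Y (j + k) =
                -(m * Y j) + -(m * Y (j + k)) + m * m := by ring
            rw [this]
            refine (abs_add_le _ _).trans (add_le_add ((abs_add_le _ _).trans ?_) ?_)
            · rw [abs_neg, abs_neg, abs_mul, abs_mul]
            · rw [abs_mul]
        _ = |m| * ∑ j ∈ Finset.Icc 1 (n - k), |Y j| + |m| * ∑ j ∈ Finset.Icc 1 (n - k), |Y (j + k)|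
            + ∑ _j ∈ Finset.Icc 1 (n - k), |m| * |m| := by
            rw [Finset.sum_add_distrib, Finset.sum_add_distrib, Finset.mul_sum, Finset.mul_sum]
        _ ≤ _ := by nlinarith [abs_nonneg m]
    calc _ ≤ (n : ℝ)⁻¹ * (3 * |m| * A) := mul_le_mul_of_nonneg_left h6 (by positivity)
      _ = _ := by ring

/-- Evenness folds the sum. The ranges can then be exchanged since the autocovariance vanishes at
lags k ≥ n and the window beyond 1/b_n. -/
lemma kernelEstimator_eq {w : ℝ → ℝ} (hw : AssumptionA3 w) (b : ℕ → ℝ) (Y : ℕ → ℝ) {n : ℕ}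
    (hb : 0 < b n) :
    kernelEstimator w b Y n = 2 * ∑ k ∈ Finset.range (⌊1 / b n⌋₊ + 2),
      w (k * b n) * sampleAutocov Y n k - sampleAutocov Y n 0 := by
  have heven : Function.Even fun k : ℤ => w ((k : ℝ) * b n) * sampleAutocov Y n k := by
    intro k
    simp only [sampleAutocov, Int.natAbs_neg]
    congr 1
    push_cast
    rw [neg_mul, hw.even]
  unfold kernelEstimator
  rw [Finset.sum_Icc_of_even_eq_range heven, two_nsmul, ← two_mul]
  simp only [Int.cast_zero, zero_mul, hw.zero, one_mul, Int.cast_natCast]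
  congr 2
  have h1 : ∀ k, k ∉ Finset.range (n + 1) → w (k * b n) * sampleAutocov Y n k = 0 := by
    intro k hk
    have : n ≤ (k : ℤ).natAbs := by rw [Finset.mem_range] at hk; rw [Int.natAbs_natCast]; omega
    rw [sampleAutocov, if_pos this, mul_zero]
  have h2 : ∀ k, k ∉ Finset.range (⌊1 / b n⌋₊ + 2) → w (k * b n) * sampleAutocov Y n k = 0 := by
    intro k hk
    rw [hw.eq_zero_of_floor_lt hb (by rw [Finset.mem_range] at hk; omega), zero_mul]
  rw [Finset.sum_subset (Finset.subset_union_left (s₂ := Finset.range (⌊1 / b n⌋₊ + 2)))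
      fun k _ hk => h1 k hk,
    Finset.sum_subset (Finset.subset_union_right (s₁ := Finset.range (n + 1)))
      fun k _ hk => h2 k hk]

/-- The centring error of one lag is multiplied by the number of active lags; the extra 1 accounts
for lag zero, which the folded sum counts twice. -/
lemma abs_kernelEstimator_sub_lagForm_le {w : ℝ → ℝ} (hw : AssumptionA3 w) {B : ℝ}
    (hB : ∀ x, |w x| ≤ B) (b : ℕ → ℝ) (Y : ℕ → ℝ) (hY : Y 0 = 0) {n : ℕ} (hn : 1 ≤ n)
    (hb : 0 < b n) :
    |kernelEstimator w b Y n - lagForm (fun k => w (k * b n)) Y (⌊1 / b n⌋₊ + 1) n| ≤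
      3 * (2 * ((⌊1 / b n⌋₊ + 2 : ℕ) : ℝ) * B + 1) *
        (|sampleMean Y n| * ((n : ℝ)⁻¹ * ∑ j ∈ Finset.Icc 1 n, |Y j|)) := by
  set m := ⌊1 / b n⌋₊
  set E := |sampleMean Y n| * ((n : ℝ)⁻¹ * ∑ j ∈ Finset.Icc 1 n, |Y j|) with hE
  set c : ℕ → ℝ := fun k => (n : ℝ)⁻¹ * ∑ j ∈ Finset.Icc 1 n, Y j * Y (j - k) with hcdef
  have hc : ∀ k : ℕ, |sampleAutocov Y n k - c k| ≤ 3 * E := fun k => by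
    rw [hE, ← mul_assoc]; exact abs_sampleAutocov_sub_le Y hY hn k
  have hE0 : 0 ≤ E := by positivity
  have hlag : lagForm (fun k => w (k * b n)) Y (m + 1) n =
      2 * ∑ k ∈ Finset.range (m + 2), w (k * b n) * c k - c 0 := by
    rw [Finset.sum_range_succ', lagForm]
    simp only [Nat.cast_zero, zero_mul, hw.zero, one_mul, pastSum]
    have h0 : c 0 = (n : ℝ)⁻¹ * ∑ j ∈ Finset.Icc 1 n, Y j ^ 2 := by
      simp [hcdef, sq]
    have h1 : ∑ k ∈ Finset.range (m + 1), w ((k + 1 : ℕ) * b n) * c (k + 1) =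
        (n : ℝ)⁻¹ * ∑ j ∈ Finset.Icc 1 n, Y j *
          ∑ k ∈ Finset.range (m + 1), w ((k + 1 : ℕ) * b n) * Y (j - (k + 1)) := by
      simp only [hcdef, Finset.mul_sum]
      rw [Finset.sum_comm]
      exact Finset.sum_congr rfl fun _ _ => Finset.sum_congr rfl fun _ _ => by ring
    rw [h1, h0]
    ring
  rw [kernelEstimator_eq hw b Y hb, hlag]
  have hsum : |∑ k ∈ Finset.range (m + 2), w (k * b n) * (sampleAutocov Y n k - c k)| ≤
      ((m + 2 : ℕ) : ℝ) * (B * (3 * E)) := by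
    refine (Finset.abs_sum_le_sum_abs _ _).trans ?_
    refine (Finset.sum_le_card_nsmul _ _ (B * (3 * E)) fun k _ => ?_).trans ?_
    · rw [abs_mul]
      exact mul_le_mul (hB _) (hc k) (abs_nonneg _) ((abs_nonneg _).trans (hB 0))
    · simp
  have h0 := hc 0
  have hid : 2 * ∑ k ∈ Finset.range (m + 2), w (k * b n) * sampleAutocov Y n k -
      sampleAutocov Y n 0 - (2 * ∑ k ∈ Finset.range (m + 2), w (k * b n) * c k - c 0) =
      2 * ∑ k ∈ Finset.range (m + 2), w (k * b n) * (sampleAutocov Y n k - c k) -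
      (sampleAutocov Y n (0 : ℕ) - c 0) := by
    simp only [mul_sub, Finset.sum_sub_distrib, Nat.cast_zero]
    ring
  rw [hid]
  refine (abs_sub _ _).trans ?_
  rw [abs_mul, abs_two]
  linarith

/-- Summation by parts with a sequence `σ` that vanishes at `0`. -/
lemma sum_mul_sub_eq (u σ : ℕ → ℝ) (hσ : σ 0 = 0) (T : ℕ) :
    ∑ k ∈ Finset.range T, u k * (σ (k + 1) - σ k) =
      ∑ k ∈ Finset.range T, (u k - u (k + 1)) * σ (k + 1) + u T * σ T := by
  induction T with
  | zero => simp [hσ]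
  | succ T ih => rw [Finset.sum_range_succ, Finset.sum_range_succ, ih]; ring

/-- The increment of the past sums, up to `Y j`, is controlled by the oscillation of the partial
sums of `Y` and by the second differences of the weights. -/
lemma abs_pastSum_increment_le (v Y : ℕ → ℝ) (hY : Y 0 = 0) (hv0 : v 0 = 1) (K : ℕ)
    (hv : ∀ k, K < k → v k = 0) (j : ℕ) (G : ℝ)
    (hG : ∀ k, k ≤ K + 1 →
      |∑ i ∈ Finset.Icc 1 j, Y i - ∑ i ∈ Finset.Icc 1 (j - k), Y i| ≤ G) :
    |pastSum v Y K j + Y j - pastSum v Y K (j + 1)| ≤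
      (∑ k ∈ Finset.range (K + 1), |(v k - v (k + 1)) - (v (k + 1) - v (k + 2))|) * G := by
  set S : ℕ → ℝ := fun j => ∑ i ∈ Finset.Icc 1 j, Y i with hS
  have h1 : pastSum v Y K j + Y j = ∑ k ∈ Finset.range (K + 1), v k * Y (j - k) := by
    rw [Finset.sum_range_succ', pastSum]; simp [hv0]
  have h2 : pastSum v Y K (j + 1) = ∑ k ∈ Finset.range (K + 1), v (k + 1) * Y (j - k) := by
    rw [Finset.sum_range_succ, hv (K + 1) (by omega), zero_mul, add_zero, pastSum]
    exact Finset.sum_congr rfl fun k _ => by rw [Nat.add_sub_add_right]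
  have h3 : ∀ k, Y (j - k) = (S j - S (j - (k + 1))) - (S j - S (j - k)) := by
    intro k
    rcases Nat.lt_or_ge k j with hk | hk
    · obtain ⟨i, hi⟩ : ∃ i, j - k = i + 1 := ⟨j - k - 1, by omega⟩
      have hi' : j - (k + 1) = i := by omega
      rw [hi, hi']
      simp only [hS]
      rw [Finset.sum_Icc_succ_top (by omega)]
      ring
    · have e1 : j - k = 0 := by omega
      have e2 : j - (k + 1) = 0 := by omega
      rw [e1, e2, hY]; ring
  -- A second summation by parts. The boundary term vanishes because the weights are zero past K.
  have h4 : pastSum v Y K j + Y j - pastSum v Y K (j + 1) = ∑ k ∈ Finset.range (K + 1),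
      ((v k - v (k + 1)) - (v (k + 1) - v (k + 2))) * (S j - S (j - (k + 1))) := by
    rw [h1, h2, ← Finset.sum_sub_distrib]
    have := sum_mul_sub_eq (fun k => v k - v (k + 1)) (fun k => S j - S (j - k)) (by simp) (K + 1)
    rw [hv (K + 1) (by omega), hv (K + 1 + 1) (by omega)] at this
    rw [sub_self, zero_mul, add_zero] at this
    rw [← this]
    refine Finset.sum_congr rfl fun k _ => ?_
    rw [← sub_mul, h3 k]
  rw [h4, Finset.sum_mul]
  refine (Finset.abs_sum_le_sum_abs _ _).trans (Finset.sum_le_sum fun k hk => ?_)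
  rw [abs_mul]
  exact mul_le_mul_of_nonneg_left (hG (k + 1) (by simp at hk; omega)) (abs_nonneg _)

/-- The decomposition of the quadratic form, when `Y_j = D_j + U_{j-1} - U_j + R_j`. -/
lemma sum_sq_add_sum_mul_eq (Y D U R H : ℕ → ℝ)
    (hYD : ∀ j, Y (j + 1) = D (j + 1) + U j - U (j + 1) + R (j + 1)) (n : ℕ) :
    ∑ j ∈ Finset.Icc 1 n, Y j ^ 2 + 2 * ∑ j ∈ Finset.Icc 1 n, Y j * H j =
      ∑ j ∈ Finset.Icc 1 n, D j ^ 2 + 2 * ∑ j ∈ Finset.Icc 1 n, D j * U (j - 1)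
      + (U 0 ^ 2 - U n ^ 2)
      + ∑ j ∈ Finset.Icc 1 n, (R j ^ 2 + 2 * (R j * (D j + U (j - 1))))
      + 2 * ∑ j ∈ Finset.Icc 1 n, D j * H j
      + 2 * ∑ j ∈ Finset.Icc 1 n, R j * H j
      + 2 * (U 0 * H 1 - U n * H (n + 1))
      - 2 * ∑ j ∈ Finset.Icc 1 n, U j * (H j + Y j - H (j + 1)) := by
  -- The mechanism behind the identity: summation by parts turns ∑ (U_{j-1} - U_j) H_j into boundary
  -- terms and -∑ U_j (H_j - H_{j+1}). Adding and subtracting U_j Y_j completes the square, Y_j² + 2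
  -- U_j Y_j = (D_j + U_{j-1} + R_j)² - U_j², in which the squares of U telescope.
  induction n with
  | zero => simp
  | succ n ih =>
    simp only [Finset.sum_Icc_succ_top (Nat.le_add_left 1 n), Nat.add_sub_cancel] at ih ⊢
    have h := hYD n
    have e : U (n + 1) = D (n + 1) + U n + R (n + 1) - Y (n + 1) := by rw [h]; ring
    rw [e]
    linear_combination ih

/-! ### Bounds of `L^p` norms -/

/-- `f` is measurable and `‖f‖_p ≤ c`. -/
structure NormLE {Ω : Type*} [MeasurableSpace Ω] (μ : Measure Ω) (p : ℝ≥0∞) (f : Ω → ℝ)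
    (c : ℝ) : Prop where
  measurable : Measurable f
  eLpNorm_le : eLpNorm f p μ ≤ ENNReal.ofReal c

section NormLE

variable {Ω : Type*} [MeasurableSpace Ω] {μ : Measure Ω} {p : ℝ≥0∞} {f g : Ω → ℝ} {a c : ℝ}

lemma NormLE.memLp (h : NormLE μ p f c) : MemLp f p μ :=
  ⟨h.measurable.aestronglyMeasurable, h.eLpNorm_le.trans_lt ENNReal.ofReal_lt_top⟩

lemma NormLE.mono (h : NormLE μ p f c) (hca : c ≤ a) : NormLE μ p f a :=
  ⟨h.measurable, h.eLpNorm_le.trans (ENNReal.ofReal_le_ofReal hca)⟩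

lemma NormLE.mono_fun (h : NormLE μ p f c) (hg : Measurable g) (hgf : ∀ ω, |g ω| ≤ |f ω|) :
    NormLE μ p g c :=
  ⟨hg, (eLpNorm_mono fun ω => by simpa [Real.norm_eq_abs] using hgf ω).trans h.eLpNorm_le⟩

lemma NormLE.abs (h : NormLE μ p f c) : NormLE μ p (fun ω => |f ω|) c :=
  h.mono_fun h.measurable.abs fun ω => by simp

lemma NormLE.neg (h : NormLE μ p f c) : NormLE μ p (fun ω => -f ω) c :=
  h.mono_fun h.measurable.neg fun ω => by simp

lemma NormLE.zero (μ : Measure Ω) (p : ℝ≥0∞) (c : ℝ) : NormLE μ p (fun _ => 0) c :=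
  ⟨measurable_const, by simp⟩

lemma NormLE.add (hp : 1 ≤ p) (ha : 0 ≤ a) (hc : 0 ≤ c) (hf : NormLE μ p f a)
    (hg : NormLE μ p g c) : NormLE μ p (fun ω => f ω + g ω) (a + c) := by
  refine ⟨hf.measurable.add hg.measurable, ?_⟩
  rw [ENNReal.ofReal_add ha hc]
  exact (eLpNorm_add_le hf.measurable.aestronglyMeasurable hg.measurable.aestronglyMeasurable
    hp).trans (add_le_add hf.eLpNorm_le hg.eLpNorm_le)

lemma NormLE.sub (hp : 1 ≤ p) (ha : 0 ≤ a) (hc : 0 ≤ c) (hf : NormLE μ p f a)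
    (hg : NormLE μ p g c) : NormLE μ p (fun ω => f ω - g ω) (a + c) := by
  simpa [sub_eq_add_neg] using hf.add hp ha hc hg.neg

lemma NormLE.sum {ι : Type*} (hp : 1 ≤ p) {s : Finset ι} {f : ι → Ω → ℝ} {c : ι → ℝ}
    (hc : ∀ i ∈ s, 0 ≤ c i) (h : ∀ i ∈ s, NormLE μ p (f i) (c i)) :
    NormLE μ p (fun ω => ∑ i ∈ s, f i ω) (∑ i ∈ s, c i) := by
  refine ⟨Finset.measurable_sum s fun i hi => (h i hi).measurable, ?_⟩
  rw [ENNReal.ofReal_sum_of_nonneg hc]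
  have : (fun ω => ∑ i ∈ s, f i ω) = ∑ i ∈ s, f i := by ext; simp
  rw [this]
  exact (eLpNorm_sum_le (fun i hi => (h i hi).measurable.aestronglyMeasurable) hp).trans
    (Finset.sum_le_sum fun i hi => (h i hi).eLpNorm_le)

lemma NormLE.const_mul (b : ℝ) (h : NormLE μ p f c) : NormLE μ p (fun ω => b * f ω) (|b| * c) := by
  refine ⟨h.measurable.const_mul b, ?_⟩
  rw [ENNReal.ofReal_mul (abs_nonneg b)]
  have h1 : eLpNorm (b • f) p μ ≤ ‖b‖ₑ * eLpNorm f p μ := eLpNorm_const_smul_le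
  rw [Real.enorm_eq_ofReal_abs] at h1
  exact h1.trans (mul_le_mul_right h.eLpNorm_le _)

lemma NormLE.mul {q r : ℝ≥0∞} [ENNReal.HolderTriple p q r] (ha : 0 ≤ a) (hf : NormLE μ p f a)
    (hg : NormLE μ q g c) : NormLE μ r (fun ω => f ω * g ω) (a * c) := by
  refine ⟨hf.measurable.mul hg.measurable, ?_⟩
  rw [ENNReal.ofReal_mul ha]
  exact (eLpNorm_smul_le_mul_eLpNorm (f := g) (φ := f) hg.measurable.aestronglyMeasurable
    hf.measurable.aestronglyMeasurable).trans (mul_le_mul' hf.eLpNorm_le hg.eLpNorm_le)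

instance holderTriple_four_four_two : ENNReal.HolderTriple 4 4 2 where
  inv_add_inv_eq_inv := by
    rw [← two_mul, ← ENNReal.toReal_eq_toReal_iff' (by finiteness) (by finiteness)]
    norm_num

lemma NormLE.mono_exponent [IsProbabilityMeasure μ] {q : ℝ≥0∞} (hpq : p ≤ q) (h : NormLE μ q f c) :
    NormLE μ p f c :=
  ⟨h.measurable, (eLpNorm_le_eLpNorm_of_exponent_le hpq h.measurable.aestronglyMeasurable).trans
    h.eLpNorm_le⟩

lemma eLpNorm_two_sq (f : Ω → ℝ) : eLpNorm f 2 μ ^ 2 = ∫⁻ ω, ENNReal.ofReal (f ω ^ 2) ∂μ := by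
  have h := eLpNorm_nnreal_pow_eq_lintegral (μ := μ) (f := f) (p := 2) two_ne_zero
  have h2 : ((2 : NNReal) : ℝ) = ((2 : ℕ) : ℝ) := by norm_num
  rw [h2, ENNReal.rpow_natCast] at h
  simp only [ENNReal.rpow_natCast] at h
  rw [ENNReal.coe_ofNat] at h
  rw [h]
  refine lintegral_congr fun ω => ?_
  rw [Real.enorm_eq_ofReal_abs, ← ENNReal.ofReal_pow (abs_nonneg _), sq_abs]

lemma normLE_two_iff (hf : Measurable f) (hc : 0 ≤ c) :
    NormLE μ 2 f c ↔ ∫⁻ ω, ENNReal.ofReal (f ω ^ 2) ∂μ ≤ ENNReal.ofReal (c ^ 2) := by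
  rw [← eLpNorm_two_sq, ENNReal.ofReal_pow hc]
  constructor
  · intro h; exact pow_le_pow_left₀ (by positivity) h.eLpNorm_le 2
  · intro h; exact ⟨hf, le_of_sq_le_sq h⟩
  where le_of_sq_le_sq {x y : ℝ≥0∞} (h : x ^ 2 ≤ y ^ 2) : x ≤ y :=
    (ENNReal.pow_le_pow_left_iff two_ne_zero).1 h

lemma NormLE.integral_sq_le (hc : 0 ≤ c) (h : NormLE μ 2 f c) : ∫ ω, f ω ^ 2 ∂μ ≤ c ^ 2 := by
  have h1 := (normLE_two_iff h.measurable hc).1 h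
  rw [integral_eq_lintegral_of_nonneg_ae (Eventually.of_forall fun ω => sq_nonneg _)
    (h.measurable.pow_const 2).aestronglyMeasurable]
  exact ENNReal.toReal_le_of_le_ofReal (by positivity) h1

lemma normLE_two_of_integral_sq_le (hf : MemLp f 2 μ) (hm : Measurable f) (hc : 0 ≤ c)
    (h : ∫ ω, f ω ^ 2 ∂μ ≤ c ^ 2) : NormLE μ 2 f c := by
  rw [normLE_two_iff hm hc, ← ofReal_integral_eq_lintegral_ofReal hf.integrable_sq
    (Eventually.of_forall fun ω => sq_nonneg _)]
  exact ENNReal.ofReal_le_ofReal h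

/-- Finitely many square-integrable functions have a common square-integrable bound. -/
lemma exists_normLE_bound {ι : Type*} (s : Finset ι) {f : ι → Ω → ℝ} (hc : 0 ≤ c)
    (h : ∀ i ∈ s, NormLE μ 2 (f i) c) :
    ∃ G : Ω → ℝ, NormLE μ 2 G (c * √s.card) ∧ ∀ ω, ∀ i ∈ s, |f i ω| ≤ G ω := by
  -- The common bound is the ℓ² norm of the family, which costs only the square root of its
  -- cardinality.
  have hm : Measurable fun ω => ∑ i ∈ s, f i ω ^ 2 :=
    Finset.measurable_sum s fun i hi => (h i hi).measurable.pow_const 2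
  refine ⟨fun ω => √(∑ i ∈ s, f i ω ^ 2), ?_, fun ω i hi => ?_⟩
  · rw [normLE_two_iff (by fun_prop) (by positivity)]
    have h1 : ∀ ω, ENNReal.ofReal (√(∑ i ∈ s, f i ω ^ 2) ^ 2) =
        ∑ i ∈ s, ENNReal.ofReal (f i ω ^ 2) := fun ω => by
      rw [Real.sq_sqrt (Finset.sum_nonneg fun i _ => sq_nonneg _),
        ENNReal.ofReal_sum_of_nonneg fun i _ => sq_nonneg _]
    simp_rw [h1]
    rw [lintegral_finsetSum' s fun i hi =>
      ((h i hi).measurable.pow_const 2).ennreal_ofReal.aemeasurable]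
    calc _ ≤ ∑ _i ∈ s, ENNReal.ofReal (c ^ 2) :=
          Finset.sum_le_sum fun i hi => (normLE_two_iff (h i hi).measurable hc).1 (h i hi)
      _ = _ := by
          rw [Finset.sum_const, mul_pow, Real.sq_sqrt (by positivity), mul_comm (c ^ 2),
            ENNReal.ofReal_mul (by positivity), ENNReal.ofReal_natCast, nsmul_eq_mul]
  · rw [← Real.sqrt_sq_eq_abs]
    exact Real.sqrt_le_sqrt (Finset.single_le_sum (f := fun i => f i ω ^ 2)
      (fun i _ => sq_nonneg _) hi)

end NormLE

/-! ### Almost sure convergence from norm bounds -/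

section Convergence

variable {Ω : Type*} [MeasurableSpace Ω] {μ : Measure Ω}

/-- The sum of |f_n| has finite mean, hence is almost surely finite. -/
lemma ae_tendsto_zero_of_summable {f : ℕ → Ω → ℝ} {c : ℕ → ℝ} (hc : Summable c)
    (hc0 : ∀ n, 0 ≤ c n) (hf : ∀ n, NormLE μ 1 (f n) (c n)) :
    ∀ᵐ ω ∂μ, Tendsto (fun n => f n ω) atTop (𝓝 0) := by
  have h1 : ∫⁻ ω, ∑' n, ‖f n ω‖ₑ ∂μ ≠ ∞ := by
    rw [lintegral_tsum fun n => (hf n).measurable.enorm.aemeasurable]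
    refine ne_top_of_le_ne_top ?_ (ENNReal.tsum_le_tsum (g := fun n => ENNReal.ofReal (c n))
      fun n => ?_)
    · rw [← ENNReal.ofReal_tsum_of_nonneg hc0 hc]; exact ENNReal.ofReal_ne_top
    · rw [← eLpNorm_one_eq_lintegral_enorm]; exact (hf n).eLpNorm_le
  have h2 := ae_lt_top' (AEMeasurable.tsum fun n => (hf n).measurable.enorm.aemeasurable) h1
  filter_upwards [h2] with ω hω
  have h3 := ENNReal.tendsto_atTop_zero_of_tsum_ne_top hω.ne
  rw [tendsto_zero_iff_norm_tendsto_zero]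
  have h4 := (ENNReal.tendsto_toReal ENNReal.zero_ne_top).comp h3
  simpa [Function.comp_def] using h4

/-- The maximum of `|e_n|` over dyadic blocks decays polynomially in mean. -/
def BlockSmall (μ : Measure Ω) (e : ℕ → Ω → ℝ) : Prop :=
  ∃ C s : ℝ, 0 ≤ C ∧ s < 0 ∧ ∀ N : ℕ, 1 ≤ N → ∃ G : Ω → ℝ, NormLE μ 1 G (C * (N : ℝ) ^ s) ∧
    ∀ ω, ∀ n, N ≤ n → n < 2 * N → |e n ω| ≤ G ω

/-- Along N = 2^p the bounds form a geometric series, so the block bounds tend to zero almost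
surely; each n ≥ 1 lies in the block p = log₂ n. -/
lemma BlockSmall.tendsto {e : ℕ → Ω → ℝ} (he : BlockSmall μ e) :
    ∀ᵐ ω ∂μ, Tendsto (fun n => e n ω) atTop (𝓝 0) := by
  obtain ⟨C, s, hC, hs, h⟩ := he
  choose G hG hGe using fun p : ℕ => h (2 ^ p) Nat.one_le_two_pow
  have hr : ∀ p : ℕ, (((2 ^ p : ℕ) : ℝ)) ^ s = ((2 : ℝ) ^ s) ^ p := fun p => by
    push_cast
    rw [← Real.rpow_natCast, ← Real.rpow_natCast, ← Real.rpow_mul two_pos.le,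
      ← Real.rpow_mul two_pos.le, mul_comm]
  have hsum : Summable fun p : ℕ => C * (((2 ^ p : ℕ) : ℝ)) ^ s := by
    simp_rw [hr]
    exact (summable_geometric_of_lt_one (by positivity)
      (Real.rpow_lt_one_of_one_lt_of_neg one_lt_two hs)).mul_left C
  filter_upwards [ae_tendsto_zero_of_summable hsum (fun p => by positivity) hG] with ω hω
  have hlog : Tendsto (fun n : ℕ => Nat.log 2 n) atTop atTop := by
    refine tendsto_atTop.2 fun p => ?_
    filter_upwards [eventually_ge_atTop (2 ^ p)] with n hn
    exact (Nat.le_log_iff_pow_le one_lt_two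
      (by have := Nat.one_le_two_pow (n := p); omega)).2 hn
  refine squeeze_zero_norm' ?_ (hω.comp hlog)
  filter_upwards [eventually_ge_atTop 1] with n hn
  refine hGe _ ω n (Nat.pow_log_le_self 2 (by omega)) ?_
  have := Nat.lt_pow_succ_log_self one_lt_two n
  rwa [pow_succ, mul_comm] at this

/-- For sums controlled term by term no maximal inequality is needed: the sum of absolute values up
to 2N dominates the whole block. The terms may depend on the block, which accommodates weights
varying with n. -/
lemma blockSmall_of_sum {e : ℕ → Ω → ℝ} (f : ℕ → ℕ → Ω → ℝ) (c : ℕ → ℕ → ℝ) {C s a : ℝ}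
    (hC : 0 ≤ C) (hs : s < 0) (ha : a ≤ 0) (hc0 : ∀ N j, 0 ≤ c N j)
    (hf : ∀ N j, 1 ≤ j → NormLE μ 1 (f N j) (c N j))
    (hc : ∀ N : ℕ, 1 ≤ N → (N : ℝ) ^ a * ∑ j ∈ Finset.Icc 1 (2 * N), c N j ≤ C * (N : ℝ) ^ s)
    (he : ∀ ω N n, 1 ≤ N → N ≤ n → n < 2 * N →
      |e n ω| ≤ (n : ℝ) ^ a * ∑ j ∈ Finset.Icc 1 n, |f N j ω|) : BlockSmall μ e := by
  refine ⟨C, s, hC, hs, fun N hN => ⟨fun ω => (N : ℝ) ^ a * ∑ j ∈ Finset.Icc 1 (2 * N), |f N j ω|,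
    ?_, fun ω n hn hn2 => (he ω N n hN hn hn2).trans ?_⟩⟩
  · have := (NormLE.sum (s := Finset.Icc 1 (2 * N)) le_rfl (fun j _ => hc0 N j) fun j hj =>
      (hf N j (Finset.mem_Icc.1 hj).1).abs).const_mul ((N : ℝ) ^ a)
    rw [abs_of_nonneg (by positivity)] at this
    exact this.mono (hc N hN)
  · have hN0 : (0 : ℝ) < N := by exact_mod_cast hN
    refine mul_le_mul (Real.rpow_le_rpow_of_nonpos hN0 (by exact_mod_cast hn) ha) ?_
      (Finset.sum_nonneg fun _ _ => abs_nonneg _) (by positivity)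
    exact Finset.sum_le_sum_of_subset_of_nonneg (Finset.Icc_subset_Icc le_rfl hn2.le)
      fun _ _ _ => abs_nonneg _

/-- The squares have means O(n^{2s}) with 2s < -1, so they are summable. The shift by one avoids n =
0, where nothing is assumed. -/
lemma ae_tendsto_zero_of_normLE_two {e : ℕ → Ω → ℝ} {C s : ℝ} (hC : 0 ≤ C) (hs : s < -(1 / 2))
    (he : ∀ n : ℕ, 1 ≤ n → NormLE μ 2 (e n) (C * (n : ℝ) ^ s)) :
    ∀ᵐ ω ∂μ, Tendsto (fun n => e n ω) atTop (𝓝 0) := by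
  have hsum : Summable fun n : ℕ => C ^ 2 * ((n + 1 : ℕ) : ℝ) ^ (2 * s) :=
    (((Real.summable_nat_rpow (p := 2 * s)).2 (by linarith)).mul_left (C ^ 2)).comp_injective
      (add_left_injective 1)
  have h2 : ∀ n, NormLE μ 1 (fun ω => e (n + 1) ω * e (n + 1) ω)
      (C ^ 2 * ((n + 1 : ℕ) : ℝ) ^ (2 * s)) := fun n => by
    have := (he (n + 1) (by omega)).mul (r := 1) (by positivity) (he (n + 1) (by omega))
    refine this.mono (le_of_eq ?_)
    rw [two_mul, Real.rpow_add (by positivity)]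
    ring
  filter_upwards [ae_tendsto_zero_of_summable hsum (fun n => by positivity) h2] with ω hω
  rw [← tendsto_add_atTop_iff_nat 1]
  have h3 := (Real.continuous_sqrt.tendsto 0).comp hω
  rw [Real.sqrt_zero] at h3
  rw [tendsto_zero_iff_abs_tendsto_zero]
  refine h3.congr fun n => ?_
  simp [Real.sqrt_mul_self_eq_abs]

end Convergence

/-! ### Martingale differences and the maximal inequality -/

section RunningMax

variable {Ω : Type*}

/-- The running maximum, from `0`, of the partial sums of `ξ`. -/
noncomputable def runningMax (ξ : ℕ → Ω → ℝ) : ℕ → Ω → ℝ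
  | 0 => fun _ => 0
  | n + 1 => fun ω => max (runningMax ξ n ω) (∑ j ∈ Finset.Icc 1 (n + 1), ξ j ω)

lemma runningMax_nonneg (ξ : ℕ → Ω → ℝ) (n : ℕ) (ω : Ω) : 0 ≤ runningMax ξ n ω := by
  induction n with
  | zero => exact le_rfl
  | succ n ih => exact ih.trans (le_max_left _ _)

lemma sum_le_runningMax (ξ : ℕ → Ω → ℝ) (ω : Ω) {n N : ℕ} (hn : n ≤ N) :
    ∑ j ∈ Finset.Icc 1 n, ξ j ω ≤ runningMax ξ N ω := by
  induction N, hn using Nat.le_induction with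
  | base =>
    cases n with
    | zero => simp [runningMax]
    | succ n => exact le_max_right _ _
  | succ N _ ih => exact ih.trans (le_max_left _ _)

/-- A pathwise form of Doob's inequality. In the last sum the maximum is taken one step before the
increment, so this sum has mean zero for martingale differences. -/
lemma runningMax_sq_le (ξ : ℕ → Ω → ℝ) (n : ℕ) (ω : Ω) :
    runningMax ξ n ω ^ 2 ≤ 2 * ((∑ j ∈ Finset.Icc 1 n, ξ j ω) * runningMax ξ n ω)
      - 2 * ∑ k ∈ Finset.range n, runningMax ξ k ω * ξ (k + 1) ω := by
  induction n with
  | zero => simp [runningMax]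
  | succ n ih =>
    rw [Finset.sum_range_succ]
    have hS : ∑ j ∈ Finset.Icc 1 (n + 1), ξ j ω = ∑ j ∈ Finset.Icc 1 n, ξ j ω + ξ (n + 1) ω :=
      Finset.sum_Icc_succ_top (by omega) _
    have hm : runningMax ξ (n + 1) ω =
        max (runningMax ξ n ω) (∑ j ∈ Finset.Icc 1 (n + 1), ξ j ω) := rfl
    rcases le_total (runningMax ξ n ω) (∑ j ∈ Finset.Icc 1 (n + 1), ξ j ω) with h | h
    · rw [max_eq_right h] at hm
      rw [hm, hS] at *
      nlinarith
    · rw [max_eq_left h] at hm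
      rw [hm, hS]
      nlinarith

lemma measurable_runningMax {F : ℕ → MeasurableSpace Ω} (hF : Monotone F) {ξ : ℕ → Ω → ℝ} (hξ : ∀ j, Measurable[F j] (ξ j))
    (n : ℕ) : Measurable[F n] (runningMax ξ n) := by
  induction n with
  | zero => exact measurable_const
  | succ n ih =>
    refine Measurable.max (ih.mono (hF n.le_succ) le_rfl) ?_
    exact Finset.measurable_sum _ fun j hj => (hξ j).mono (hF (Finset.mem_Icc.1 hj).2) le_rfl

end RunningMax

section Martingale

variable {Ω : Type*} [mΩ : MeasurableSpace Ω] {μ : Measure Ω}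

/-- `ξ` is a sequence of martingale differences for `F`: `ξ_{j+1}` is orthogonal to the functions
measurable with respect to `F_j`. -/
structure IsMartingaleDiff (F : ℕ → MeasurableSpace Ω) (μ : Measure Ω) (ξ : ℕ → Ω → ℝ) :
    Prop where
  adapted : ∀ j, Measurable[F j] (ξ j)
  integral_mul_eq_zero : ∀ j (Z : Ω → ℝ), Measurable[F j] Z →
    Integrable (fun ω => Z ω * ξ (j + 1) ω) μ → ∫ ω, Z ω * ξ (j + 1) ω ∂μ = 0

variable {F : ℕ → MeasurableSpace Ω}

/-- Orthogonality to every Z with integrable product, not only to bounded Z, makes this a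
reassociation of factors, without truncation. -/
lemma IsMartingaleDiff.predictable_mul (hF : Monotone F) {ξ : ℕ → Ω → ℝ}
    (h : IsMartingaleDiff F μ ξ) {Z : ℕ → Ω → ℝ} (hZ : ∀ j, Measurable[F (j - 1)] (Z j)) :
    IsMartingaleDiff F μ fun j ω => Z j ω * ξ j ω := by
  refine ⟨fun j => Measurable.mul ((hZ j).mono (hF (Nat.sub_le j 1)) le_rfl) (h.adapted j),
    fun j W hW hint => ?_⟩
  have hWZ : Measurable[F j] fun ω => W ω * Z (j + 1) ω := Measurable.mul hW (hZ (j + 1))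
  simp only [← mul_assoc] at hint ⊢
  exact h.integral_mul_eq_zero j _ hWZ hint

lemma memLp_runningMax {ξ : ℕ → Ω → ℝ} (hξ : ∀ j, MemLp (ξ j) 2 μ) (n : ℕ) :
    MemLp (runningMax ξ n) 2 μ := by
  induction n with
  | zero => exact MemLp.zero
  | succ n ih =>
    exact ih.sup (memLp_finsetSum _ fun j _ => hξ j)

lemma IsMartingaleDiff.integral_sum_sq (hF : Monotone F) {ξ : ℕ → Ω → ℝ}
    (h : IsMartingaleDiff F μ ξ) (hξ : ∀ j, MemLp (ξ j) 2 μ) (n : ℕ) :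
    ∫ ω, (∑ j ∈ Finset.Icc 1 n, ξ j ω) ^ 2 ∂μ = ∑ j ∈ Finset.Icc 1 n, ∫ ω, ξ j ω ^ 2 ∂μ := by
  induction n with
  | zero => simp
  | succ n ih =>
    have hS : MemLp (fun ω => ∑ j ∈ Finset.Icc 1 n, ξ j ω) 2 μ := memLp_finsetSum _ fun j _ => hξ j
    have hmeas : Measurable[F n] fun ω => ∑ j ∈ Finset.Icc 1 n, ξ j ω :=
      Finset.measurable_sum _ fun j hj => (h.adapted j).mono (hF (Finset.mem_Icc.1 hj).2) le_rfl
    have hint : Integrable (fun ω => (∑ j ∈ Finset.Icc 1 n, ξ j ω) * ξ (n + 1) ω) μ :=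
      hS.integrable_mul (hξ (n + 1))
    have h0 := h.integral_mul_eq_zero n _ hmeas hint
    simp only [Finset.sum_Icc_succ_top (Nat.le_add_left 1 n)]
    have e : ∀ ω, (∑ j ∈ Finset.Icc 1 n, ξ j ω + ξ (n + 1) ω) ^ 2 =
        (∑ j ∈ Finset.Icc 1 n, ξ j ω) ^ 2 + 2 * ((∑ j ∈ Finset.Icc 1 n, ξ j ω) * ξ (n + 1) ω)
          + ξ (n + 1) ω ^ 2 := fun ω => by ring
    simp_rw [e]
    have hadd : Integrable (fun ω => (∑ j ∈ Finset.Icc 1 n, ξ j ω) ^ 2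
        + 2 * ((∑ j ∈ Finset.Icc 1 n, ξ j ω) * ξ (n + 1) ω)) μ :=
      hS.integrable_sq.add (hint.const_mul 2)
    rw [integral_add hadd (hξ (n + 1)).integrable_sq, integral_add hS.integrable_sq (hint.const_mul 2), integral_const_mul, h0, ih]
    ring

lemma IsMartingaleDiff.integral_runningMax_sq_le (hF : Monotone F) {ξ : ℕ → Ω → ℝ}
    (h : IsMartingaleDiff F μ ξ) (hξ : ∀ j, MemLp (ξ j) 2 μ) (n : ℕ) :
    ∫ ω, runningMax ξ n ω ^ 2 ∂μ ≤ 4 * ∑ j ∈ Finset.Icc 1 n, ∫ ω, ξ j ω ^ 2 ∂μ := by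
  have hS : MemLp (fun ω => ∑ j ∈ Finset.Icc 1 n, ξ j ω) 2 μ := memLp_finsetSum _ fun j _ => hξ j
  have hint : ∀ k, Integrable (fun ω => runningMax ξ k ω * ξ (k + 1) ω) μ := fun k =>
    (memLp_runningMax hξ k).integrable_mul (hξ (k + 1))
  have h0 : ∀ k, ∫ ω, runningMax ξ k ω * ξ (k + 1) ω ∂μ = 0 := fun k =>
    h.integral_mul_eq_zero k _ (measurable_runningMax hF h.adapted k) (hint k)
  have hM := (memLp_runningMax hξ n).integrable_sq
  have hle : ∀ ω, runningMax ξ n ω ^ 2 ≤ 4 * (∑ j ∈ Finset.Icc 1 n, ξ j ω) ^ 2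
      - 4 * ∑ k ∈ Finset.range n, runningMax ξ k ω * ξ (k + 1) ω := fun ω => by
    -- With M the maximum and S the sum, 2SM ≤ M²/2 + 2S² absorbs half of M² into the left side.
    have := runningMax_sq_le ξ n ω
    nlinarith [sq_nonneg (runningMax ξ n ω - 2 * ∑ j ∈ Finset.Icc 1 n, ξ j ω)]
  have hs : Integrable (fun ω => ∑ k ∈ Finset.range n, runningMax ξ k ω * ξ (k + 1) ω) μ :=
    integrable_finsetSum _ fun k _ => hint k
  calc _ ≤ ∫ ω, (4 * (∑ j ∈ Finset.Icc 1 n, ξ j ω) ^ 2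
        - 4 * ∑ k ∈ Finset.range n, runningMax ξ k ω * ξ (k + 1) ω) ∂μ :=
        integral_mono hM ((hS.integrable_sq.const_mul 4).sub (hs.const_mul 4)) hle
    _ = _ := by
        rw [integral_sub (hS.integrable_sq.const_mul 4) (hs.const_mul 4), integral_const_mul,
          integral_const_mul, integral_finsetSum _ fun k _ => hint k,
          Finset.sum_eq_zero fun k _ => h0 k, h.integral_sum_sq hF hξ]
        ring

/-- **Doob's maximal inequality** in `L²`. -/
lemma IsMartingaleDiff.exists_maximal_bound (hF : Monotone F) (hle : ∀ n, F n ≤ mΩ)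
    {ξ : ℕ → Ω → ℝ} (h : IsMartingaleDiff F μ ξ) {c : ℕ → ℝ} (hc0 : ∀ j, 0 ≤ c j)
    (hc : ∀ j, NormLE μ 2 (ξ j) (c j)) (N : ℕ) :
    ∃ G : Ω → ℝ, NormLE μ 2 G (4 * √(∑ j ∈ Finset.Icc 1 N, c j ^ 2)) ∧
      ∀ ω, ∀ n, n ≤ N → |∑ j ∈ Finset.Icc 1 n, ξ j ω| ≤ G ω := by
  have key : ∀ ξ : ℕ → Ω → ℝ, IsMartingaleDiff F μ ξ → (∀ j, NormLE μ 2 (ξ j) (c j)) →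
      NormLE μ 2 (runningMax ξ N) (2 * √(∑ j ∈ Finset.Icc 1 N, c j ^ 2)) := by
    intro ξ h hc
    have hmem : ∀ j, MemLp (ξ j) 2 μ := fun j => (hc j).memLp
    refine normLE_two_of_integral_sq_le (memLp_runningMax hmem N)
      ((measurable_runningMax hF h.adapted N).mono (hle N) le_rfl) (by positivity) ?_
    refine (h.integral_runningMax_sq_le hF hmem N).trans ?_
    rw [mul_pow, Real.sq_sqrt (Finset.sum_nonneg fun _ _ => sq_nonneg _)]
    have := Finset.sum_le_sum fun j (_ : j ∈ Finset.Icc 1 N) => (hc j).integral_sq_le (hc0 j)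
    linarith
  -- The running maximum is one-sided, so it is used for ξ and -ξ; this doubles the constant to 4.
  have hneg : IsMartingaleDiff F μ fun j ω => -ξ j ω := by
    have := h.predictable_mul hF (Z := fun _ _ => -1) fun j => measurable_const
    simpa using this
  have h1 := key ξ h hc
  have h2 := key _ hneg fun j => (hc j).neg
  refine ⟨fun ω => runningMax ξ N ω + runningMax (fun j ω => -ξ j ω) N ω,
    (h1.add one_le_two (by positivity) (by positivity) h2).mono (le_of_eq (by ring)),
    fun ω n hn => ?_⟩
  have e1 := sum_le_runningMax ξ ω hn
  have e2 := sum_le_runningMax (fun j ω => -ξ j ω) ω hn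
  rw [Finset.sum_neg_distrib] at e2
  have e3 := runningMax_nonneg ξ N ω
  have e4 := runningMax_nonneg (fun j ω => -ξ j ω) N ω
  exact abs_le.2 ⟨by linarith, by linarith⟩

end Martingale

/-! ### The estimator for a sequence with a martingale approximation -/

/-- `Y_j = D_j + U_{j-1} - U_j + R_j` with martingale differences `D`, adapted `U` and small
remainders `R`, all bounded in `L⁴`. -/
structure MartingaleApprox {Ω : Type*} [mΩ : MeasurableSpace Ω] (F : ℕ → MeasurableSpace Ω)
    (μ : Measure Ω) (D U R Y : ℕ → Ω → ℝ) (C : ℝ) (ρ : ℕ → ℝ) : Prop where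
  mono : Monotone F
  le : ∀ n, F n ≤ mΩ
  diff : IsMartingaleDiff F μ D
  adapted_U : ∀ j, Measurable[F j] (U j)
  adapted_Y : ∀ j, Measurable[F j] (Y j)
  Y_zero : ∀ ω, Y 0 ω = 0
  Y_succ : ∀ j ω, Y (j + 1) ω = D (j + 1) ω + U j ω - U (j + 1) ω + R (j + 1) ω
  norm_D : ∀ j, NormLE μ 4 (D j) C
  norm_U : ∀ j, NormLE μ 4 (U j) C
  norm_Y : ∀ j, NormLE μ 4 (Y j) C
  norm_R : ∀ j, 1 ≤ j → NormLE μ 4 (R j) (ρ j)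
  ρ_nonneg : ∀ j, 0 ≤ ρ j
  sum_ρ : ∀ s : Finset ℕ, ∑ j ∈ s, ρ j ≤ C * √s.card

lemma sum_Icc_sub_sum_Icc (f : ℕ → ℝ) {n j : ℕ} (h : n ≤ j) :
    ∑ i ∈ Finset.Icc 1 j, f i - ∑ i ∈ Finset.Icc 1 n, f i = ∑ i ∈ Finset.Ioc n j, f i := by
  induction j, h using Nat.le_induction with
  | base => simp
  | succ j hj ih =>
    rw [Finset.sum_Icc_succ_top (by omega), Finset.sum_Ioc_succ_top hj, ← ih]
    ring

lemma sqrt_two_mul_le (x : ℝ) : √(2 * x) ≤ 2 * √x := by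
  rw [Real.sqrt_mul two_pos.le]
  have h : √2 ≤ 2 := by
    rw [Real.sqrt_le_left two_pos.le]; norm_num
  exact mul_le_mul_of_nonneg_right h (Real.sqrt_nonneg x)

lemma inv_mul_rpow_mul_sqrt {x : ℝ} (hx : 0 < x) (s : ℝ) :
    x⁻¹ * (x ^ s * √x) = x ^ (s - 1 / 2) := by
  rw [Real.sqrt_eq_rpow, ← Real.rpow_neg_one, ← Real.rpow_add hx, ← Real.rpow_add hx]
  congr 1; ring

lemma abs_pastSum_le {v Y : ℕ → ℝ} {B : ℝ} (hv : ∀ k, |v k| ≤ B) {K L : ℕ} (hKL : K ≤ L) (j : ℕ) :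
    |pastSum v Y K j| ≤ B * ∑ k ∈ Finset.range L, |Y (j - (k + 1))| := by
  have hB : 0 ≤ B := (abs_nonneg _).trans (hv 0)
  rw [Finset.mul_sum]
  refine (Finset.abs_sum_le_sum_abs _ _).trans ?_
  refine (Finset.sum_le_sum fun k _ => ?_).trans
    (Finset.sum_le_sum_of_subset_of_nonneg (Finset.range_mono hKL) fun k _ _ => by positivity)
  rw [abs_mul]
  exact mul_le_mul_of_nonneg_right (hv _) (abs_nonneg _)

namespace MartingaleApprox

variable {Ω : Type*} [mΩ : MeasurableSpace Ω] {F : ℕ → MeasurableSpace Ω} {μ : Measure Ω}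
  {D U R Y : ℕ → Ω → ℝ} {C : ℝ} {ρ : ℕ → ℝ}

lemma C_nonneg (h : MartingaleApprox F μ D U R Y C ρ) : 0 ≤ C := by
  have := h.sum_ρ {0}
  simp only [Finset.sum_singleton, Finset.card_singleton, Nat.cast_one, Real.sqrt_one,
    mul_one] at this
  exact (h.ρ_nonneg 0).trans this

lemma ρ_le (h : MartingaleApprox F μ D U R Y C ρ) (j : ℕ) : ρ j ≤ C := by
  simpa using h.sum_ρ {j}

lemma sum_ρ_le (h : MartingaleApprox F μ D U R Y C ρ) (N : ℕ) :
    ∑ j ∈ Finset.Icc 1 (2 * N), ρ j ≤ 2 * C * √N := by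
  refine (h.sum_ρ _).trans ?_
  rw [Nat.card_Icc, Nat.add_sub_cancel]
  push_cast
  nlinarith [mul_le_mul_of_nonneg_left (sqrt_two_mul_le (N : ℝ)) h.C_nonneg]

lemma sum_Y (h : MartingaleApprox F μ D U R Y C ρ) (n : ℕ) (ω : Ω) :
    ∑ j ∈ Finset.Icc 1 n, Y j ω =
      ∑ j ∈ Finset.Icc 1 n, D j ω + (U 0 ω - U n ω) + ∑ j ∈ Finset.Icc 1 n, R j ω := by
  induction n with
  | zero => simp
  | succ n ih =>
    simp only [Finset.sum_Icc_succ_top (Nat.le_add_left 1 n)]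
    rw [ih, h.Y_succ]
    ring

/-- Maximal inequality for the martingale transforms of `D`. -/
lemma exists_transform_bound (h : MartingaleApprox F μ D U R Y C ρ) {Z : ℕ → Ω → ℝ}
    (hZ : ∀ j, Measurable[F (j - 1)] (Z j)) (hZn : ∀ j, NormLE μ 4 (Z j) C) (N : ℕ) :
    ∃ G : Ω → ℝ, NormLE μ 2 G (8 * C ^ 2 * √N) ∧
      ∀ ω, ∀ n, n ≤ 2 * N → |∑ j ∈ Finset.Icc 1 n, D j ω * Z j ω| ≤ G ω := by
  obtain ⟨G, hG, hle⟩ := (h.diff.predictable_mul h.mono hZ).exists_maximal_bound h.mono h.le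
    (c := fun _ => C * C) (fun _ => mul_self_nonneg C)
    (fun j => (hZn j).mul h.C_nonneg (h.norm_D j)) (2 * N)
  refine ⟨G, hG.mono ?_, fun ω n hn => ?_⟩
  · rw [Finset.sum_const, Nat.card_Icc, Nat.add_sub_cancel, nsmul_eq_mul,
      Real.sqrt_mul (by positivity), Real.sqrt_sq (mul_self_nonneg C)]
    push_cast
    nlinarith [mul_le_mul_of_nonneg_right (sqrt_two_mul_le (N : ℝ)) (mul_self_nonneg C)]
  · simpa only [mul_comm] using hle ω n hn

variable {v : ℕ → ℕ → ℝ} {κ L : ℕ → ℕ} {A B δ : ℝ}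

lemma tendsto_mean_U_sq (h : MartingaleApprox F μ D U R Y C ρ) :
    ∀ᵐ ω ∂μ, Tendsto (fun n : ℕ => (n : ℝ)⁻¹ * (U 0 ω ^ 2 - U n ω ^ 2)) atTop (𝓝 0) := by
  have hC := h.C_nonneg
  refine ae_tendsto_zero_of_normLE_two (C := 2 * C ^ 2) (s := -1) (by positivity) (by norm_num)
    fun n hn => ?_
  have h1 : ∀ j, NormLE μ 2 (fun ω => U j ω ^ 2) (C ^ 2) := fun j => by
    simpa only [← sq] using (h.norm_U j).mul (r := 2) hC (h.norm_U j)
  refine (((h1 0).sub one_le_two (by positivity) (by positivity) (h1 n)).const_mul _).mono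
    (le_of_eq ?_)
  rw [abs_of_nonneg (by positivity), Real.rpow_neg_one]
  ring

/-- Counting the O(n^δ) lags gives an L² norm O(n^{δ-1}), and δ - 1 < -1/2. -/
lemma tendsto_U_mul_pastSum (h : MartingaleApprox F μ D U R Y C ρ) (hA : 0 ≤ A)
    (hv : ∀ n k, |v n k| ≤ B) (hκ : ∀ N n, N ≤ n → n < 2 * N → κ n ≤ L N)
    (hL : ∀ N : ℕ, 1 ≤ N → (L N : ℝ) ≤ A * (N : ℝ) ^ δ) (hδ : δ < 1 / 2) :
    ∀ᵐ ω ∂μ, Tendsto (fun n : ℕ => (n : ℝ)⁻¹ *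
      (U n ω * pastSum (v n) (fun j => Y j ω) (κ n) (n + 1))) atTop (𝓝 0) := by
  have hC := h.C_nonneg
  have hB : 0 ≤ B := (abs_nonneg _).trans (hv 0 0)
  refine ae_tendsto_zero_of_normLE_two (C := A * B * C ^ 2) (s := δ - 1) (by positivity)
    (by linarith) fun n hn => ?_
  have hn0 : (0 : ℝ) < n := by exact_mod_cast hn
  have h1 : NormLE μ 4 (fun ω => pastSum (v n) (fun j => Y j ω) (κ n) (n + 1))
      (∑ _k ∈ Finset.range (κ n), B * C) :=
    NormLE.sum (by norm_num) (fun _ _ => by positivity) fun k _ =>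
      ((h.norm_Y _).const_mul (v n (k + 1))).mono (mul_le_mul_of_nonneg_right (hv n _) hC)
  rw [Finset.sum_const, Finset.card_range, nsmul_eq_mul] at h1
  refine (((h.norm_U n).mul (r := 2) hC h1).const_mul _).mono ?_
  have h2 : (κ n : ℝ) ≤ A * (n : ℝ) ^ δ :=
    le_trans (by exact_mod_cast hκ n n le_rfl (by omega)) (hL n hn)
  rw [abs_of_nonneg (by positivity), sub_eq_add_neg, Real.rpow_add hn0, Real.rpow_neg_one]
  calc _ = (n : ℝ)⁻¹ * B * C ^ 2 * κ n := by ring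
    _ ≤ (n : ℝ)⁻¹ * B * C ^ 2 * (A * (n : ℝ) ^ δ) := mul_le_mul_of_nonneg_left h2 (by positivity)
    _ = _ := by ring

variable [IsProbabilityMeasure μ]

/-- The oscillation of the partial sums of `Y` over windows of length `K` is `O(√K)` in `L²`. -/
lemma exists_window_bound (h : MartingaleApprox F μ D U R Y C ρ) (j : ℕ) {K : ℕ} (hK : 1 ≤ K) :
    ∃ G : Ω → ℝ, NormLE μ 2 G (13 * C * √K) ∧ ∀ ω, ∀ k, k ≤ K →
      |∑ i ∈ Finset.Icc 1 j, Y i ω - ∑ i ∈ Finset.Icc 1 (j - k), Y i ω| ≤ G ω := by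
  have hC := h.C_nonneg
  -- A deterministic indicator restricts the martingale to the window (j - K, j], so Doob's
  -- inequality costs √K and not √j.
  have hZ : ∀ i, Measurable[F (i - 1)] fun _ : Ω => if j - K < i then (1 : ℝ) else 0 :=
    fun i => measurable_const
  obtain ⟨G₁, hG₁, hle₁⟩ := (h.diff.predictable_mul h.mono hZ).exists_maximal_bound h.mono h.le
    (c := fun i => if j - K < i then C else 0) (fun i => by positivity)
    (fun i => by
      split_ifs with hi
      · simpa using (h.norm_D i).mono_exponent (by norm_num)
      · simpa using NormLE.zero μ 2 0) j
  have hsq : √(∑ i ∈ Finset.Icc 1 j, (if j - K < i then C else 0) ^ 2) ≤ C * √K := by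
    have e : ∑ i ∈ Finset.Icc 1 j, (if j - K < i then C else 0) ^ 2 ≤ K * C ^ 2 := by
      simp only [ite_pow, ne_eq, OfNat.ofNat_ne_zero, not_false_eq_true, zero_pow]
      rw [← Finset.sum_filter, Finset.sum_const, nsmul_eq_mul]
      refine mul_le_mul_of_nonneg_right ?_ (sq_nonneg C)
      have : (Finset.Icc 1 j).filter (fun i => j - K < i) ⊆ Finset.Ioc (j - K) j := by
        intro i hi
        simp only [Finset.mem_filter, Finset.mem_Icc, Finset.mem_Ioc] at hi ⊢
        omega
      have h2 := Finset.card_le_card this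
      rw [Nat.card_Ioc] at h2
      exact_mod_cast h2.trans (by omega)
    calc _ ≤ √(K * C ^ 2) := Real.sqrt_le_sqrt e
      _ = _ := by rw [Real.sqrt_mul (by positivity), Real.sqrt_sq hC, mul_comm]
  obtain ⟨G₂, hG₂, hle₂⟩ := exists_normLE_bound (μ := μ) (f := U) (Finset.Icc (j - K) j) hC
    fun i _ => (h.norm_U i).mono_exponent (by norm_num)
  have hcard : √((Finset.Icc (j - K) j).card : ℝ) ≤ 2 * √K := by
    refine (Real.sqrt_le_sqrt ?_).trans (sqrt_two_mul_le (K : ℝ))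
    rw [Nat.card_Icc]
    exact_mod_cast (by omega : j + 1 - (j - K) ≤ 2 * K)
  have hG₃ : NormLE μ 2 (fun ω => ∑ i ∈ Finset.Ioc (j - K) j, |R i ω|) (C * √K) := by
    refine (NormLE.sum one_le_two (fun i _ => h.ρ_nonneg i) fun i hi =>
      ((h.norm_R i (by have := (Finset.mem_Ioc.1 hi).1; omega)).abs.mono_exponent
        (by norm_num))).mono ?_
    refine (h.sum_ρ _).trans (mul_le_mul_of_nonneg_left (Real.sqrt_le_sqrt ?_) hC)
    rw [Nat.card_Ioc]
    exact_mod_cast (by omega : j - (j - K) ≤ K)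
  -- G₁ and G₂ enter twice, for the two end times j and j - k. The constant is 13 = 2·4 + 2·2 + 1,
  -- from D, U and R.
  refine ⟨fun ω => (2 * G₁ ω + 2 * G₂ ω) + ∑ i ∈ Finset.Ioc (j - K) j, |R i ω|, ?_,
    fun ω k hk => ?_⟩
  · refine (((hG₁.const_mul 2).add one_le_two (by positivity) (by positivity)
      (hG₂.const_mul 2)).add one_le_two (by positivity) (by positivity) hG₃).mono ?_
    rw [abs_two]
    have := mul_le_mul_of_nonneg_left hcard hC
    linarith
  · rw [h.sum_Y j, h.sum_Y (j - k)]
    have e1 : ∑ i ∈ Finset.Icc 1 j, D i ω - ∑ i ∈ Finset.Icc 1 (j - k), D i ω =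
        ∑ i ∈ Finset.Icc 1 j, (if j - K < i then (1 : ℝ) else 0) * D i ω
        - ∑ i ∈ Finset.Icc 1 (j - k), (if j - K < i then (1 : ℝ) else 0) * D i ω := by
      rw [sum_Icc_sub_sum_Icc _ (Nat.sub_le j k), sum_Icc_sub_sum_Icc _ (Nat.sub_le j k)]
      refine Finset.sum_congr rfl fun i hi => ?_
      rw [if_pos (by have := (Finset.mem_Ioc.1 hi).1; omega), one_mul]
    have e2 : |∑ i ∈ Finset.Icc 1 j, R i ω - ∑ i ∈ Finset.Icc 1 (j - k), R i ω| ≤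
        ∑ i ∈ Finset.Ioc (j - K) j, |R i ω| := by
      rw [sum_Icc_sub_sum_Icc _ (Nat.sub_le j k)]
      refine (Finset.abs_sum_le_sum_abs _ _).trans (Finset.sum_le_sum_of_subset_of_nonneg
        (Finset.Ioc_subset_Ioc_left (by omega)) fun _ _ _ => abs_nonneg _)
    have h1 := abs_le.1 (hle₁ ω j le_rfl)
    have h2 := abs_le.1 (hle₁ ω (j - k) (Nat.sub_le j k))
    have h3 := abs_le.1 (hle₂ ω j (Finset.mem_Icc.2 ⟨Nat.sub_le j K, le_rfl⟩))
    have h4 := abs_le.1 (hle₂ ω (j - k) (Finset.mem_Icc.2 ⟨by omega, Nat.sub_le j k⟩))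
    have h5 := abs_le.1 e2
    rw [abs_le]
    constructor <;> linarith

lemma tendsto_mean_D_mul_U (h : MartingaleApprox F μ D U R Y C ρ) :
    ∀ᵐ ω ∂μ, Tendsto (fun n : ℕ => (n : ℝ)⁻¹ * ∑ j ∈ Finset.Icc 1 n, D j ω * U (j - 1) ω)
      atTop (𝓝 0) := by
  refine BlockSmall.tendsto ⟨8 * C ^ 2, -(1 / 2), by positivity, by norm_num, fun N hN => ?_⟩
  have hN0 : (0 : ℝ) < N := by exact_mod_cast hN
  obtain ⟨G, hG, hle⟩ := h.exists_transform_bound (fun j => h.adapted_U (j - 1))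
    (fun j => h.norm_U (j - 1)) N
  refine ⟨fun ω => (N : ℝ)⁻¹ * G ω, ?_, fun ω n hn hn2 => ?_⟩
  · refine ((hG.mono_exponent one_le_two).const_mul _).mono (le_of_eq ?_)
    rw [abs_of_pos (inv_pos.2 hN0)]
    have := inv_mul_rpow_mul_sqrt hN0 0
    rw [Real.rpow_zero, one_mul, zero_sub] at this
    rw [← this]; ring
  · rw [abs_mul, abs_of_nonneg (by positivity)]
    have hnN : (n : ℝ)⁻¹ ≤ (N : ℝ)⁻¹ := inv_anti₀ hN0 (by exact_mod_cast hn)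
    exact mul_le_mul hnN (hle ω n hn2.le) (abs_nonneg _) (by positivity)

/-- The weights change with n, so the sum is not a martingale in n. Exchanging the sums isolates,
for each lag, a martingale transform free of n, whose maximum over a block is O(√N); summing over
O(N^δ) lags gives O(N^{δ-1/2}) after normalisation. -/
lemma tendsto_mean_D_mul_pastSum (h : MartingaleApprox F μ D U R Y C ρ) (hA : 0 ≤ A)
    (hv : ∀ n k, |v n k| ≤ B) (hκ : ∀ N n, N ≤ n → n < 2 * N → κ n ≤ L N)
    (hL : ∀ N : ℕ, 1 ≤ N → (L N : ℝ) ≤ A * (N : ℝ) ^ δ) (hδ : δ < 1 / 2) :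
    ∀ᵐ ω ∂μ, Tendsto (fun n : ℕ => (n : ℝ)⁻¹ * ∑ j ∈ Finset.Icc 1 n,
      D j ω * pastSum (v n) (fun j => Y j ω) (κ n) j) atTop (𝓝 0) := by
  have hB : 0 ≤ B := (abs_nonneg _).trans (hv 0 0)
  refine BlockSmall.tendsto ⟨B * A * (8 * C ^ 2), δ - 1 / 2, by positivity, by linarith,
    fun N hN => ?_⟩
  have hN0 : (0 : ℝ) < N := by exact_mod_cast hN
  choose G hG hle using fun k : ℕ => h.exists_transform_bound (Z := fun j => Y (j - (k + 1)))
    (fun j => (h.adapted_Y (j - (k + 1))).mono (h.mono (by omega)) le_rfl)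
    (fun j => h.norm_Y _) N
  refine ⟨fun ω => ((N : ℝ)⁻¹ * B) * ∑ k ∈ Finset.range (L N), G k ω, ?_, fun ω n hn hn2 => ?_⟩
  · refine ((NormLE.sum le_rfl (fun _ _ => by positivity) fun k _ =>
      (hG k).mono_exponent one_le_two).const_mul _).mono ?_
    rw [abs_of_nonneg (by positivity), Finset.sum_const, Finset.card_range, nsmul_eq_mul,
      ← inv_mul_rpow_mul_sqrt hN0 δ]
    calc _ = (N : ℝ)⁻¹ * B * (8 * C ^ 2) * √N * L N := by ring
      _ ≤ (N : ℝ)⁻¹ * B * (8 * C ^ 2) * √N * (A * (N : ℝ) ^ δ) :=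
          mul_le_mul_of_nonneg_left (hL N hN) (by positivity)
      _ = _ := by ring
  · have hnN : (n : ℝ)⁻¹ ≤ (N : ℝ)⁻¹ := inv_anti₀ hN0 (by exact_mod_cast hn)
    rw [abs_mul, abs_of_nonneg (by positivity)]
    beta_reduce
    rw [mul_assoc (N : ℝ)⁻¹]
    refine mul_le_mul hnN ?_ (abs_nonneg _) (by positivity)
    have e : ∑ j ∈ Finset.Icc 1 n, D j ω * pastSum (v n) (fun j => Y j ω) (κ n) j =
        ∑ k ∈ Finset.range (κ n), v n (k + 1) *
          ∑ j ∈ Finset.Icc 1 n, D j ω * Y (j - (k + 1)) ω := by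
      simp only [pastSum, Finset.mul_sum]
      rw [Finset.sum_comm]
      exact Finset.sum_congr rfl fun _ _ => Finset.sum_congr rfl fun _ _ => by ring
    rw [e, Finset.mul_sum]
    refine (Finset.abs_sum_le_sum_abs _ _).trans ?_
    refine (Finset.sum_le_sum fun k _ => ?_).trans (Finset.sum_le_sum_of_subset_of_nonneg
      (Finset.range_mono (hκ N n hn hn2)) fun k _ _ =>
        mul_nonneg hB ((abs_nonneg _).trans (hle k ω 0 (by omega))))
    rw [abs_mul]
    exact mul_le_mul (hv n _) (hle k ω n hn2.le) (abs_nonneg _) hB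

/-- Each summand has mean size O(ρ_j), and the ρ_j sum to O(√N). -/
lemma tendsto_mean_R (h : MartingaleApprox F μ D U R Y C ρ) :
    ∀ᵐ ω ∂μ, Tendsto (fun n : ℕ => (n : ℝ)⁻¹ * ∑ j ∈ Finset.Icc 1 n,
      (R j ω ^ 2 + 2 * (R j ω * (D j ω + U (j - 1) ω)))) atTop (𝓝 0) := by
  have hC := h.C_nonneg
  refine (blockSmall_of_sum (fun _ j ω => R j ω ^ 2 + 2 * (R j ω * (D j ω + U (j - 1) ω)))
    (fun _ j => 5 * C * ρ j) (C := 10 * C ^ 2) (s := -(1 / 2)) (a := -1) (by positivity)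
    (by norm_num) (by norm_num) (fun _ j => by have := h.ρ_nonneg j; positivity)
    (fun _ j hj => ?_) (fun N hN => ?_) fun ω N n hN hn hn2 => ?_).tendsto
  · have hρ := h.ρ_nonneg j
    have h1 := (h.norm_R j hj).mul (r := 2) hρ (h.norm_R j hj)
    have h2 := ((h.norm_R j hj).mul (r := 2) hρ ((h.norm_D j).add (by norm_num) hC hC
      (h.norm_U (j - 1)))).const_mul 2
    have h3 := (h1.add one_le_two (by positivity) (by positivity) h2).mono_exponent one_le_two
    simp only [← sq] at h3
    refine h3.mono ?_
    rw [abs_two]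
    nlinarith [h.ρ_le j]
  · have hN0 : (0 : ℝ) < N := by exact_mod_cast hN
    have := inv_mul_rpow_mul_sqrt hN0 0
    rw [Real.rpow_zero, one_mul, zero_sub] at this
    rw [← this, Real.rpow_neg_one, ← Finset.mul_sum]
    calc _ ≤ (N : ℝ)⁻¹ * (5 * C * (2 * C * √N)) := by
          refine mul_le_mul_of_nonneg_left (mul_le_mul_of_nonneg_left (h.sum_ρ_le N) ?_) ?_ <;>
            positivity
      _ = _ := by ring
  · rw [abs_mul, abs_of_nonneg (by positivity), Real.rpow_neg_one]
    exact mul_le_mul_of_nonneg_left (Finset.abs_sum_le_sum_abs _ _) (by positivity)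

/-- The past sums are O(N^δ) in L⁴ by counting lags, and ∑ ρ_j = O(√N); the normalised product is
O(N^{δ-1/2}). -/
lemma tendsto_mean_R_mul_pastSum (h : MartingaleApprox F μ D U R Y C ρ) (hA : 0 ≤ A)
    (hv : ∀ n k, |v n k| ≤ B) (hκ : ∀ N n, N ≤ n → n < 2 * N → κ n ≤ L N)
    (hL : ∀ N : ℕ, 1 ≤ N → (L N : ℝ) ≤ A * (N : ℝ) ^ δ) (hδ : δ < 1 / 2) :
    ∀ᵐ ω ∂μ, Tendsto (fun n : ℕ => (n : ℝ)⁻¹ * ∑ j ∈ Finset.Icc 1 n,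
      R j ω * pastSum (v n) (fun j => Y j ω) (κ n) j) atTop (𝓝 0) := by
  have hC := h.C_nonneg
  have hB : 0 ≤ B := (abs_nonneg _).trans (hv 0 0)
  refine (blockSmall_of_sum
    (fun N j ω => R j ω * (B * ∑ k ∈ Finset.range (L N), |Y (j - (k + 1)) ω|))
    (fun N j => ρ j * (B * (L N * C))) (C := 2 * A * B * C ^ 2) (s := δ - 1 / 2) (a := -1)
    (by positivity) (by linarith) (by norm_num)
    (fun N j => by have := h.ρ_nonneg j; positivity)
    (fun N j hj => ?_) (fun N hN => ?_) fun ω N n hN hn hn2 => ?_).tendsto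
  · have h1 := (NormLE.sum (s := Finset.range (L N)) (by norm_num) (fun _ _ => hC)
      fun k _ => (h.norm_Y (j - (k + 1))).abs).const_mul B
    rw [Finset.sum_const, Finset.card_range, nsmul_eq_mul, abs_of_nonneg hB] at h1
    exact ((h.norm_R j hj).mul (r := 2) (h.ρ_nonneg j) h1).mono_exponent one_le_two
  · have hN0 : (0 : ℝ) < N := by exact_mod_cast hN
    rw [← inv_mul_rpow_mul_sqrt hN0 δ, Real.rpow_neg_one, ← Finset.sum_mul]
    calc _ ≤ (N : ℝ)⁻¹ * (2 * C * √N * (B * (A * (N : ℝ) ^ δ * C))) := by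
          refine mul_le_mul_of_nonneg_left (mul_le_mul (h.sum_ρ_le N)
            (mul_le_mul_of_nonneg_left (mul_le_mul_of_nonneg_right (hL N hN) hC) hB)
            ?_ ?_) ?_ <;> positivity
      _ = _ := by ring
  · rw [abs_mul, abs_of_nonneg (by positivity), Real.rpow_neg_one]
    refine mul_le_mul_of_nonneg_left ((Finset.abs_sum_le_sum_abs _ _).trans
      (Finset.sum_le_sum fun j _ => ?_)) (by positivity)
    rw [abs_mul, abs_mul (R j ω)]
    exact mul_le_mul_of_nonneg_left ((abs_pastSum_le (hv n) (hκ N n hn hn2) j).trans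
      (le_abs_self _)) (abs_nonneg _)

/-- The total second difference N^{-δ} meets a window oscillation N^{δ/2}. Absolute values of first
differences would only give O(1), with no decay. -/
lemma tendsto_mean_U_mul_increment (h : MartingaleApprox F μ D U R Y C ρ) (hA : 0 ≤ A)
    (hB : 0 ≤ B) (hv0 : ∀ n, 1 ≤ n → v n 0 = 1) (hvκ : ∀ n, 1 ≤ n → ∀ k, κ n < k → v n k = 0)
    (hTV : ∀ n : ℕ, 1 ≤ n → ∑ k ∈ Finset.range (κ n + 1),
      |(v n k - v n (k + 1)) - (v n (k + 1) - v n (k + 2))| ≤ B * (n : ℝ) ^ (-δ))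
    (hκ : ∀ N n, N ≤ n → n < 2 * N → κ n ≤ L N)
    (hL : ∀ N : ℕ, 1 ≤ N → (L N : ℝ) ≤ A * (N : ℝ) ^ δ) (hδ0 : 0 < δ) :
    ∀ᵐ ω ∂μ, Tendsto (fun n : ℕ => (n : ℝ)⁻¹ * ∑ j ∈ Finset.Icc 1 n,
      U j ω * (pastSum (v n) (fun j => Y j ω) (κ n) j + Y j ω
        - pastSum (v n) (fun j => Y j ω) (κ n) (j + 1))) atTop (𝓝 0) := by
  have hC := h.C_nonneg
  choose G hG hle using fun N j : ℕ => h.exists_window_bound j (K := L N + 1) (by omega)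
  refine (blockSmall_of_sum
    (fun N j ω => U j ω * (B * (N : ℝ) ^ (-δ) * G N j ω))
    (fun N j => C * (B * (N : ℝ) ^ (-δ) * (13 * C * √(L N + 1 : ℕ))))
    (C := 26 * B * C ^ 2 * √(A + 1)) (s := -(δ / 2)) (a := -1)
    (by positivity) (by linarith) (by norm_num) (fun N j => by positivity)
    (fun N j hj => ?_) (fun N hN => ?_) fun ω N n hN hn hn2 => ?_).tendsto
  · have h1 := (hG N j).const_mul (B * (N : ℝ) ^ (-δ))
    rw [abs_of_nonneg (by positivity)] at h1
    exact ((h.norm_U j).mono_exponent (p := 2) (by norm_num)).mul hC h1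
  · have hN0 : (0 : ℝ) < N := by exact_mod_cast hN
    have hN1 : (1 : ℝ) ≤ (N : ℝ) ^ δ := Real.one_le_rpow (by exact_mod_cast hN) hδ0.le
    have h1 : √((L N + 1 : ℕ) : ℝ) ≤ √(A + 1) * (N : ℝ) ^ (δ / 2) := by
      have e : (N : ℝ) ^ (δ / 2) = √((N : ℝ) ^ δ) := by
        rw [Real.sqrt_eq_rpow, ← Real.rpow_mul hN0.le]; congr 1; ring
      rw [e, ← Real.sqrt_mul (by positivity)]
      refine Real.sqrt_le_sqrt ?_
      push_cast
      have := hL N hN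
      linarith
    rw [Finset.sum_const, Nat.card_Icc, Nat.add_sub_cancel, nsmul_eq_mul, Real.rpow_neg_one]
    have e2 : (N : ℝ) ^ (-(δ / 2)) = (N : ℝ) ^ (-δ) * (N : ℝ) ^ (δ / 2) := by
      rw [← Real.rpow_add hN0]; congr 1; ring
    rw [e2]
    push_cast
    push_cast at h1
    calc _ = 26 * B * C ^ 2 * (N : ℝ) ^ (-δ) * √((L N : ℝ) + 1) := by field_simp; ring
      _ ≤ 26 * B * C ^ 2 * (N : ℝ) ^ (-δ) * (√(A + 1) * (N : ℝ) ^ (δ / 2)) :=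
          mul_le_mul_of_nonneg_left h1 (by positivity)
      _ = _ := by ring
  · rw [abs_mul, abs_of_nonneg (by positivity), Real.rpow_neg_one]
    have hN0 : (0 : ℝ) < N := by exact_mod_cast hN
    refine mul_le_mul_of_nonneg_left ((Finset.abs_sum_le_sum_abs _ _).trans
      (Finset.sum_le_sum fun j _ => ?_)) (by positivity)
    rw [abs_mul, abs_mul (U j ω)]
    refine mul_le_mul_of_nonneg_left (le_trans ?_ (le_abs_self _)) (abs_nonneg _)
    have hn1 : 1 ≤ n := hN.trans hn
    have hG0 : 0 ≤ G N j ω := (abs_nonneg _).trans (hle N j ω 0 (by omega))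
    refine (abs_pastSum_increment_le (v n) (fun j => Y j ω) (h.Y_zero ω) (hv0 n hn1) (κ n)
      (hvκ n hn1) j (G N j ω) fun k hk => hle N j ω k ?_).trans ?_
    · have := hκ N n hn hn2; omega
    · refine mul_le_mul_of_nonneg_right ((hTV n hn1).trans ?_) hG0
      exact mul_le_mul_of_nonneg_left
        (Real.rpow_le_rpow_of_nonpos hN0 (by exact_mod_cast hn) (by linarith)) hB

/-- A window of full length 2N ending at 2N controls all partial sums in the block at once, as S_n =
S_{2N} - (S_{2N} - S_n). -/
lemma tendsto_mean_Y (h : MartingaleApprox F μ D U R Y C ρ) {a : ℝ}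
    (ha : a < 1 / 2) :
    ∀ᵐ ω ∂μ, Tendsto (fun n : ℕ => (n : ℝ) ^ a * sampleMean (fun j => Y j ω) n) atTop (𝓝 0) := by
  have hC := h.C_nonneg
  refine BlockSmall.tendsto ⟨52 * C, a - 1 / 2, by positivity, by linarith, fun N hN => ?_⟩
  have hN0 : (0 : ℝ) < N := by exact_mod_cast hN
  obtain ⟨G, hG, hle⟩ := h.exists_window_bound (2 * N) (K := 2 * N) (by omega)
  refine ⟨fun ω => (N : ℝ) ^ (a - 1) * (2 * G ω), ?_, fun ω n hn hn2 => ?_⟩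
  · refine ((((hG.mono_exponent one_le_two)).const_mul 2).const_mul _).mono ?_
    rw [abs_two, abs_of_nonneg (by positivity), ← inv_mul_rpow_mul_sqrt hN0 a, sub_eq_add_neg,
      Real.rpow_add hN0, Real.rpow_neg_one]
    push_cast
    calc _ ≤ (N : ℝ) ^ a * (N : ℝ)⁻¹ * (2 * (13 * C * (2 * √N))) := by
          have := sqrt_two_mul_le (N : ℝ)
          gcongr
      _ = _ := by ring
  · have hn0 : (0 : ℝ) < n := by exact_mod_cast hN.trans hn
    have h1 := hle ω (2 * N) le_rfl
    have h2 := hle ω (2 * N - n) (by omega)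
    rw [Nat.sub_self, Finset.Icc_eq_empty_of_lt zero_lt_one, Finset.sum_empty, sub_zero] at h1
    rw [Nat.sub_sub_self hn2.le] at h2
    have h3 : |∑ i ∈ Finset.Icc 1 n, Y i ω| ≤ 2 * G ω := by
      rw [abs_le] at h1 h2 ⊢
      constructor <;> linarith
    simp only [sampleMean]
    rw [← mul_assoc, abs_mul, abs_of_nonneg (by positivity)]
    refine mul_le_mul ?_ h3 (abs_nonneg _) (by positivity)
    rw [← Real.rpow_neg_one, ← Real.rpow_add hn0, ← sub_eq_add_neg]
    exact Real.rpow_le_rpow_of_nonpos hN0 (by exact_mod_cast hn) (by linarith)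

/-- The average of |Y| is only bounded in mean; any factor n^{-ε} makes it vanish, and the mean of Y
has room to pay for it. -/
lemma tendsto_mean_abs_Y (h : MartingaleApprox F μ D U R Y C ρ) {ε : ℝ} (hε : 0 < ε) :
    ∀ᵐ ω ∂μ, Tendsto (fun n : ℕ => (n : ℝ) ^ (-ε - 1) * ∑ j ∈ Finset.Icc 1 n, |Y j ω|)
      atTop (𝓝 0) := by
  have hC := h.C_nonneg
  refine (blockSmall_of_sum (fun _ j => Y j) (fun _ _ => C) (C := 2 * C) (s := -ε) (a := -ε - 1)
    (by positivity) (by linarith) (by linarith) (fun _ _ => hC)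
    (fun _ j _ => (h.norm_Y j).mono_exponent (by norm_num)) (fun N hN => ?_)
    fun ω N n hN hn hn2 => ?_).tendsto
  · have hN0 : (0 : ℝ) < N := by exact_mod_cast hN
    rw [Finset.sum_const, Nat.card_Icc, Nat.add_sub_cancel, nsmul_eq_mul, sub_eq_add_neg,
      Real.rpow_add hN0, Real.rpow_neg_one]
    push_cast
    refine le_of_eq ?_
    field_simp
  · rw [abs_of_nonneg (mul_nonneg (by positivity) (Finset.sum_nonneg fun _ _ => abs_nonneg _))]

/-- The estimator applied to a sequence with a martingale approximation is asymptotically the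
empirical quadratic variation of the martingale. -/
lemma tendsto_kernelEstimator (h : MartingaleApprox F μ D U R Y C ρ) {w : ℝ → ℝ}
    (hw : AssumptionA3 w) {b : ℕ → ℝ} {c : ℝ} (hc : 0 < c) (hδ0 : 0 < δ) (hδ : δ < 1 / 2)
    (hb : ∀ n : ℕ, 1 ≤ n → b n = c * (n : ℝ) ^ (-δ)) :
    ∀ᵐ ω ∂μ, Tendsto (fun n : ℕ => kernelEstimator w b (fun j => Y j ω) n
      - (n : ℝ)⁻¹ * ∑ j ∈ Finset.Icc 1 n, D j ω ^ 2) atTop (𝓝 0) := by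
  obtain ⟨B, hB0, hB, hTV⟩ := hw.exists_bound
  have hinv : ∀ n : ℕ, 1 ≤ n → 1 / b n = (n : ℝ) ^ δ / c := fun n hn => by
    rw [hb n hn, Real.rpow_neg (by positivity)]
    field_simp
  have hbpos : ∀ n : ℕ, 1 ≤ n → 0 < b n := fun n hn => by
    have : (0 : ℝ) < n := by exact_mod_cast hn
    rw [hb n hn]; positivity
  -- The last lag at which the weight can be nonzero, plus one. As 1/b_n increases, `κ (2 * N)`
  -- serves as the common bound on a block.
  set κ : ℕ → ℕ := fun n => ⌊1 / b n⌋₊ + 1 with hκdef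
  have hκ : ∀ N n, N ≤ n → n < 2 * N → κ n ≤ κ (2 * N) := by
    intro N n hn hn2
    simp only [hκdef]
    rw [hinv n (by omega), hinv (2 * N) (by omega)]
    refine Nat.add_le_add_right (Nat.floor_mono ?_) 1
    gcongr
  have hL : ∀ N : ℕ, 1 ≤ N → (κ (2 * N) : ℝ) ≤ (2 / c + 1) * (N : ℝ) ^ δ := by
    intro N hN
    have hN1 : (1 : ℝ) ≤ (N : ℝ) ^ δ := Real.one_le_rpow (by exact_mod_cast hN) hδ0.le
    have h2 : (2 : ℝ) ^ δ ≤ 2 := by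
      simpa using Real.rpow_le_rpow_of_exponent_le one_le_two (by linarith : δ ≤ 1)
    simp only [hκdef]
    rw [hinv (2 * N) (by omega)]
    push_cast
    have h3 := Nat.floor_le (by positivity : 0 ≤ (2 * (N : ℝ)) ^ δ / c)
    rw [Real.mul_rpow two_pos.le (by positivity)] at h3 ⊢
    have h4 : (2 : ℝ) ^ δ * (N : ℝ) ^ δ / c ≤ 2 * (N : ℝ) ^ δ / c := by gcongr
    calc _ ≤ 2 * (N : ℝ) ^ δ / c + (N : ℝ) ^ δ := by linarith
      _ = _ := by ring
  have hA : (0 : ℝ) ≤ 2 / c + 1 := by positivity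
  set v : ℕ → ℕ → ℝ := fun n k => w (k * b n) with hvdef
  have hv : ∀ n k, |v n k| ≤ B := fun n k => hB _
  have hv0 : ∀ n, 1 ≤ n → v n 0 = 1 := fun n _ => by simp [hvdef, hw.zero]
  have hvκ : ∀ n, 1 ≤ n → ∀ k, κ n < k → v n k = 0 := fun n hn k hk =>
    hw.eq_zero_of_floor_lt (hbpos n hn) ((Nat.lt_succ_self _).trans hk)
  have hTV' : ∀ n : ℕ, 1 ≤ n → ∑ k ∈ Finset.range (κ n + 1),
      |(v n k - v n (k + 1)) - (v n (k + 1) - v n (k + 2))| ≤ (B * c) * (n : ℝ) ^ (-δ) :=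
    fun n hn => by
      have := hTV (b n) (hbpos n hn)
      rw [mul_assoc, ← hb n hn]
      exact this
  -- Half the gap between δ and 1/2: in the centring error the n^δ lags are split as n^{δ+ε} on the
  -- mean and n^{-ε} on the average of |Y|.
  have hε : 0 < (1 / 2 - δ) / 2 := by linarith
  filter_upwards [h.tendsto_mean_D_mul_U, h.tendsto_mean_D_mul_pastSum hA hv hκ hL hδ,
    h.tendsto_mean_R, h.tendsto_mean_R_mul_pastSum hA hv hκ hL hδ,
    h.tendsto_mean_U_mul_increment hA (by positivity) hv0 hvκ hTV' hκ hL hδ0,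
    h.tendsto_mean_U_sq, h.tendsto_U_mul_pastSum hA hv hκ hL hδ,
    h.tendsto_mean_Y (a := δ + (1 / 2 - δ) / 2) (by linarith),
    h.tendsto_mean_abs_Y hε] with ω t₁ t₂ t₃ t₄ t₅ t₆ t₇ t₈ t₉
  have hmain : Tendsto (fun n : ℕ => lagForm (v n) (fun j => Y j ω) (κ n) n
      - (n : ℝ)⁻¹ * ∑ j ∈ Finset.Icc 1 n, D j ω ^ 2) atTop (𝓝 0) := by
    have ht := ((((((t₁.const_mul 2).add t₆).add t₃).add (t₂.const_mul 2)).add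
      (t₄.const_mul 2)).sub (t₇.const_mul 2)).sub (t₅.const_mul 2)
    simp only [mul_zero, add_zero, sub_zero] at ht
    refine ht.congr fun n => ?_
    -- At time 1 every past index truncates to 0, where Y vanishes.
    have hH1 : pastSum (v n) (fun j => Y j ω) (κ n) 1 = 0 :=
      Finset.sum_eq_zero fun k _ => by simp [h.Y_zero ω]
    rw [lagForm, sum_sq_add_sum_mul_eq (fun j => Y j ω) (fun j => D j ω) (fun j => U j ω)
      (fun j => R j ω) (pastSum (v n) (fun j => Y j ω) (κ n)) (fun j => h.Y_succ j ω), hH1]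
    ring
  have hcenter : Tendsto (fun n : ℕ => kernelEstimator w b (fun j => Y j ω) n
      - lagForm (v n) (fun j => Y j ω) (κ n) n) atTop (𝓝 0) := by
    have ht := ((t₈.abs).mul t₉).const_mul (3 * (2 * (2 / c + 2) * B + 1))
    simp only [abs_zero, mul_zero] at ht
    refine squeeze_zero_norm' ?_ ht
    filter_upwards [eventually_ge_atTop 1] with n hn
    have hn0 : (0 : ℝ) < n := by exact_mod_cast hn
    refine (abs_kernelEstimator_sub_lagForm_le hw hB b (fun j => Y j ω) (h.Y_zero ω) hn
      (hbpos n hn)).trans ?_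
    have hn1 : (1 : ℝ) ≤ (n : ℝ) ^ δ := Real.one_le_rpow (by exact_mod_cast hn) hδ0.le
    have hk : ((⌊1 / b n⌋₊ + 2 : ℕ) : ℝ) ≤ (2 / c + 2) * (n : ℝ) ^ δ := by
      have h1 : (κ n : ℝ) ≤ κ (2 * n) := by exact_mod_cast hκ n n le_rfl (by omega)
      have h2 := hL n hn
      simp only [hκdef] at h1 h2 ⊢
      push_cast at h1 h2 ⊢
      linarith
    set T := |sampleMean (fun j => Y j ω) n| *
      ((n : ℝ)⁻¹ * ∑ j ∈ Finset.Icc 1 n, |Y j ω|) with hT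
    have hT0 : 0 ≤ T := by positivity
    have e : |(n : ℝ) ^ (δ + (1 / 2 - δ) / 2) * sampleMean (fun j => Y j ω) n| *
        ((n : ℝ) ^ (-((1 / 2 - δ) / 2) - 1) * ∑ j ∈ Finset.Icc 1 n, |Y j ω|) =
        (n : ℝ) ^ δ * T := by
      have e1 : (n : ℝ) ^ (δ + (1 / 2 - δ) / 2) * (n : ℝ) ^ (-((1 / 2 - δ) / 2) - 1) =
          (n : ℝ) ^ δ * (n : ℝ)⁻¹ := by
        rw [← Real.rpow_neg_one, ← Real.rpow_add hn0, ← Real.rpow_add hn0]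
        congr 1; ring
      rw [abs_mul, abs_of_nonneg (by positivity : 0 ≤ (n : ℝ) ^ (δ + (1 / 2 - δ) / 2)), hT]
      linear_combination (|sampleMean (fun j => Y j ω) n| * ∑ j ∈ Finset.Icc 1 n, |Y j ω|) * e1
    rw [e]
    refine le_trans (mul_le_mul_of_nonneg_right ?_ hT0) (mul_assoc _ _ _).le
    nlinarith [mul_le_mul_of_nonneg_right hk hB0.le]
  have := hcenter.add hmain
  simpa using this

end MartingaleApprox

/-! ### Geometrically ergodic kernels -/

/-- `κ` is geometrically ergodic with weight `W` and rate `C ρ^n`. -/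
structure GeomErgodic {X : Type*} [MeasurableSpace X] (κ : Kernel X X) (π : Measure X)
    (W : X → ℝ) (C ρ : ℝ) : Prop where
  measurable : Measurable W
  one_le : ∀ x, 1 ≤ W x
  C_pos : 0 < C
  ρ_pos : 0 < ρ
  ρ_lt_one : ρ < 1
  invariant : κ.Invariant π
  rate : ∀ (x : X) (n : ℕ), measNorm W ((κ ^ n) x) π ≤ ENNReal.ofReal (C * ρ ^ n * W x)

/-- `κ^n f - π(f)`. -/
noncomputable def centered {X : Type*} [MeasurableSpace X] (κ : Kernel X X) (π : Measure X)
    (n : ℕ) (f : X → ℝ) (x : X) : ℝ :=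
  ∫ y, f y ∂((κ ^ n) x) - ∫ y, f y ∂π

/-- The solution `∑_{n ≥ 0} (κ^n f - π(f))` of the Poisson equation. -/
noncomputable def poissonSol {X : Type*} [MeasurableSpace X] (κ : Kernel X X) (π : Measure X)
    (f : X → ℝ) (x : X) : ℝ :=
  ∑' n, centered κ π n f x

lemma wNorm_le_one {X : Type*} {W f : X → ℝ} (hW : ∀ x, 1 ≤ W x) (h : ∀ x, |f x| ≤ W x) :
    wNorm W f ≤ 1 := by
  refine iSup_le fun x => ?_
  rw [ENNReal.ofReal_le_one]
  exact div_le_one_of_le₀ (h x) (by linarith [hW x])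

lemma abs_le_of_wNorm_lt_top {X : Type*} {W f : X → ℝ} (hW : ∀ x, 1 ≤ W x) (h : wNorm W f < ∞) :
    ∃ c : ℝ, 0 < c ∧ ∀ x, |f x| ≤ c * W x := by
  refine ⟨(wNorm W f).toReal + 1, by positivity, fun x => ?_⟩
  have hx : 0 < W x := by linarith [hW x]
  have h1 : ENNReal.ofReal (|f x| / W x) ≤ wNorm W f :=
    le_iSup (fun x => ENNReal.ofReal (|f x| / W x)) x
  have h2 := (ENNReal.ofReal_le_iff_le_toReal h.ne).1 h1
  rw [div_le_iff₀ hx] at h2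
  linarith

namespace GeomErgodic

variable {X : Type*} [MeasurableSpace X] {κ : Kernel X X} {π : Measure X} {W : X → ℝ} {C ρ : ℝ}
  {f : X → ℝ} {c : ℝ}

lemma isMarkovKernel_pow (κ : Kernel X X) [IsMarkovKernel κ] (n : ℕ) :
    IsMarkovKernel (κ ^ n) := by
  induction n with
  | zero => rw [pow_zero]; exact inferInstanceAs (IsMarkovKernel Kernel.id)
  | succ n ih => rw [Kernel.pow_add, pow_one]; infer_instance

lemma pow_zero_apply (κ : Kernel X X) (x : X) : (κ ^ 0) x = Measure.dirac x := by
  rw [pow_zero]; exact Kernel.id_apply x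

lemma W_nonneg (h : GeomErgodic κ π W C ρ) (x : X) : 0 ≤ W x := zero_le_one.trans (h.one_le x)

lemma abs_integral_sub_le (h : GeomErgodic κ π W C ρ) {f : X → ℝ} (hf : Measurable f)
    (hfW : ∀ x, |f x| ≤ W x) (x : X) (n : ℕ) : |centered κ π n f x| ≤ C * ρ ^ n * W x := by
  have h1 := h.rate x n
  have h2 : ENNReal.ofReal |∫ y, f y ∂((κ ^ n) x) - ∫ y, f y ∂π| ≤ measNorm W ((κ ^ n) x) π :=
    le_iSup_of_le f (le_iSup_of_le hf (le_iSup_of_le (wNorm_le_one h.one_le hfW) le_rfl))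
  have h3 := h.C_pos
  have h4 := h.ρ_pos
  have h5 := h.W_nonneg x
  exact (ENNReal.ofReal_le_ofReal_iff (by positivity)).1 (h2.trans h1)

lemma abs_min_le (h : GeomErgodic κ π W C ρ) (M : ℕ) (x : X) : |min (W x) M| ≤ W x := by
  rw [abs_of_nonneg (le_min (h.W_nonneg x) (Nat.cast_nonneg M))]
  exact min_le_left _ _

lemma measurable_centered (hf : Measurable f) (n : ℕ) : Measurable (centered κ π n f) :=
  (hf.stronglyMeasurable.integral_kernel (κ := κ ^ n)).measurable.sub_const _

lemma invariant_pow (h : GeomErgodic κ π W C ρ) (n : ℕ) : (κ ^ n).Invariant π := by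
  induction n with
  | zero =>
    rw [pow_zero]
    change π.bind (Kernel.id : Kernel X X) = π
    exact Measure.bind_dirac
  | succ n ih => rw [Kernel.pow_add, pow_one]; exact ih.comp h.invariant

lemma centered_zero (hf : Measurable f) (x : X) :
    centered κ π 0 f x = f x - ∫ y, f y ∂π := by
  rw [centered, pow_zero_apply, integral_dirac' _ _ hf.stronglyMeasurable]

lemma measurable_poissonSol (hf : Measurable f) (hs : ∀ x, Summable fun n => centered κ π n f x) :
    Measurable (poissonSol κ π f) := by
  refine measurable_of_tendsto_metrizable (f := fun n x => ∑ i ∈ Finset.range n,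
    centered κ π i f x) (fun n => Finset.measurable_sum _ fun i _ => measurable_centered hf i) ?_
  exact tendsto_pi_nhds.2 fun x => (hs x).hasSum.tendsto_sum_nat

lemma abs_centered_le (h : GeomErgodic κ π W C ρ) (hc : 0 < c) (hf : Measurable f)
    (hfc : ∀ x, |f x| ≤ c * W x) (n : ℕ) (x : X) :
    |centered κ π n f x| ≤ c * C * ρ ^ n * W x := by
  have h1 := h.abs_integral_sub_le (f := fun x => c⁻¹ * f x) (hf.const_mul _) (fun x => by
    rw [abs_mul, abs_of_pos (inv_pos.2 hc), inv_mul_le_iff₀ hc]; exact hfc x) x n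
  rw [centered, integral_const_mul, integral_const_mul, ← mul_sub, abs_mul,
    abs_of_pos (inv_pos.2 hc), inv_mul_le_iff₀ hc] at h1
  calc _ ≤ _ := h1
    _ = _ := by ring

lemma abs_centered_le' (h : GeomErgodic κ π W C ρ) (hc : 0 < c) (hf : Measurable f)
    (hfc : ∀ x, |f x| ≤ c * W x) (n : ℕ) (x : X) : |centered κ π n f x| ≤ c * C * W x := by
  refine (h.abs_centered_le hc hf hfc n x).trans ?_
  refine mul_le_mul_of_nonneg_right ?_ (h.W_nonneg x)
  have := h.C_pos
  exact mul_le_of_le_one_right (by positivity) (pow_le_one₀ h.ρ_pos.le h.ρ_lt_one.le)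

lemma summable_centered (h : GeomErgodic κ π W C ρ) (hc : 0 < c) (hf : Measurable f)
    (hfc : ∀ x, |f x| ≤ c * W x) (x : X) : Summable fun n => centered κ π n f x := by
  refine Summable.of_norm_bounded (g := fun n => c * C * W x * ρ ^ n)
    ((summable_geometric_of_lt_one h.ρ_pos.le h.ρ_lt_one).mul_left _) fun n => ?_
  exact (h.abs_centered_le hc hf hfc n x).trans (le_of_eq (by ring))

lemma abs_poissonSol_le (h : GeomErgodic κ π W C ρ) (hc : 0 < c) (hf : Measurable f)
    (hfc : ∀ x, |f x| ≤ c * W x) (x : X) : |poissonSol κ π f x| ≤ c * C / (1 - ρ) * W x := by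
  have h1 : HasSum (fun n => c * C * W x * ρ ^ n) (c * C * W x * (1 - ρ)⁻¹) :=
    (hasSum_geometric_of_lt_one h.ρ_pos.le h.ρ_lt_one).mul_left _
  have h2 : ‖poissonSol κ π f x‖ ≤ c * C * W x * (1 - ρ)⁻¹ :=
    tsum_of_norm_bounded h1 fun n =>
      (h.abs_centered_le hc hf hfc n x).trans (le_of_eq (by ring))
  refine h2.trans (le_of_eq ?_)
  rw [div_eq_mul_inv]; ring

lemma summable_integral_norm (h : GeomErgodic κ π W C ρ) (hc : 0 < c) (hf : Measurable f)
    (hfc : ∀ x, |f x| ≤ c * W x) {ν : Measure X} (hν : Integrable W ν) :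
    Summable fun n => ∫ y, ‖centered κ π n f y‖ ∂ν := by
  refine Summable.of_nonneg_of_le (fun n => integral_nonneg fun y => norm_nonneg _) (fun n => ?_)
    ((summable_geometric_of_lt_one h.ρ_pos.le h.ρ_lt_one).mul_left (c * C * ∫ y, W y ∂ν))
  calc ∫ y, ‖centered κ π n f y‖ ∂ν ≤ ∫ y, c * C * ρ ^ n * W y ∂ν :=
        integral_mono_of_nonneg (Eventually.of_forall fun y => norm_nonneg _) (hν.const_mul _)
          (Eventually.of_forall fun y => h.abs_centered_le hc hf hfc n y)
    _ = _ := by rw [integral_const_mul]; ring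

lemma integrable_centered (h : GeomErgodic κ π W C ρ) (hc : 0 < c) (hf : Measurable f)
    (hfc : ∀ x, |f x| ≤ c * W x) {ν : Measure X} (hν : Integrable W ν) (n : ℕ) :
    Integrable (centered κ π n f) ν :=
  (hν.const_mul (c * C)).mono' (measurable_centered hf n).aestronglyMeasurable
    (Eventually.of_forall fun y => h.abs_centered_le' hc hf hfc n y)

lemma integrable_poissonSol (h : GeomErgodic κ π W C ρ) (hc : 0 < c) (hf : Measurable f)
    (hfc : ∀ x, |f x| ≤ c * W x) {ν : Measure X} (hν : Integrable W ν) :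
    Integrable (poissonSol κ π f) ν :=
  (hν.const_mul _).mono' (measurable_poissonSol hf
    (h.summable_centered hc hf hfc)).aestronglyMeasurable
    (Eventually.of_forall fun y => h.abs_poissonSol_le hc hf hfc y)

variable [IsProbabilityMeasure π]

/-- The weighted norm is a supremum of differences of Bochner integrals, which are zero for
nonintegrable functions, so it says nothing about W directly. Bounded truncations carry real
information, and monotone convergence transfers it to W. -/
lemma integrable_of_truncation {ν : Measure X} [IsProbabilityMeasure ν] {W : X → ℝ}
    (hW : Measurable W) (hW0 : ∀ x, 0 ≤ W x) {a : ℝ}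
    (h : ∀ M : ℕ, ∫ x, min (W x) M ∂ν ≤ a) : Integrable W ν := by
  have h1 : ∫⁻ x, ENNReal.ofReal (W x) ∂ν ≤ ENNReal.ofReal a := by
    have hsup : ∀ x, ENNReal.ofReal (W x) = ⨆ M : ℕ, ENNReal.ofReal (min (W x) M) := by
      intro x
      refine le_antisymm ?_ (iSup_le fun M => ENNReal.ofReal_le_ofReal (min_le_left _ _))
      obtain ⟨M, hM⟩ := exists_nat_ge (W x)
      exact le_iSup_of_le M (by rw [min_eq_left hM])
    simp_rw [hsup]
    rw [lintegral_iSup (fun M => (hW.min measurable_const).ennreal_ofReal)]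
    · refine iSup_le fun M => ?_
      rw [← ofReal_integral_eq_lintegral_ofReal]
      · exact ENNReal.ofReal_le_ofReal (h M)
      · refine Integrable.of_bound (C := M) (hW.min measurable_const).aestronglyMeasurable
          (Eventually.of_forall fun x => ?_)
        rw [Real.norm_eq_abs, abs_of_nonneg (le_min (hW0 x) (Nat.cast_nonneg M))]
        exact min_le_right _ _
      · exact Eventually.of_forall fun x => le_min (hW0 x) (Nat.cast_nonneg M)
    · intro M N hMN x
      exact ENNReal.ofReal_le_ofReal (min_le_min le_rfl (by exact_mod_cast hMN))
  refine ⟨hW.aestronglyMeasurable, ?_⟩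
  rw [hasFiniteIntegral_iff_ofReal (Eventually.of_forall hW0)]
  exact h1.trans_lt ENNReal.ofReal_lt_top

/-- The rate at n = 0 compares a point mass at one fixed x with π; applied to truncations of W it
bounds their π-integrals. -/
lemma integrable_weight (h : GeomErgodic κ π W C ρ) : Integrable W π := by
  obtain ⟨x⟩ : Nonempty X := nonempty_of_isProbabilityMeasure π
  refine integrable_of_truncation h.measurable h.W_nonneg (a := W x + C * W x) fun M => ?_
  have h1 := h.abs_integral_sub_le (h.measurable.min measurable_const) (h.abs_min_le M) x 0
  rw [centered, pow_zero_apply, integral_dirac' _ _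
    (h.measurable.min measurable_const).stronglyMeasurable, pow_zero, mul_one] at h1
  have h2 := (abs_le.1 h1).1
  have h3 := min_le_left (W x) (M : ℝ)
  linarith

lemma integrable_of_le (h : GeomErgodic κ π W C ρ) (hf : Measurable f)
    (hfc : ∀ x, |f x| ≤ c * W x) : Integrable f π :=
  (h.integrable_weight.const_mul c).mono' hf.aestronglyMeasurable (Eventually.of_forall hfc)

variable [IsMarkovKernel κ]

lemma integrable_weight_pow (h : GeomErgodic κ π W C ρ) (n : ℕ) (x : X) :
    Integrable W ((κ ^ n) x) := by
  have := isMarkovKernel_pow κ n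
  refine integrable_of_truncation h.measurable h.W_nonneg
    (a := ∫ y, W y ∂π + C * ρ ^ n * W x) fun M => ?_
  have h1 := h.abs_integral_sub_le (h.measurable.min measurable_const) (h.abs_min_le M) x n
  have h2 : ∫ y, min (W y) M ∂π ≤ ∫ y, W y ∂π :=
    integral_mono (h.integrable_weight.mono' (h.measurable.min measurable_const).aestronglyMeasurable
      (Eventually.of_forall fun y => h.abs_min_le M y)) h.integrable_weight fun y => min_le_left _ _
  have h3 := (abs_le.1 h1).2
  rw [centered] at h3
  linarith

lemma integrable_pow_of_le (h : GeomErgodic κ π W C ρ) (hf : Measurable f)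
    (hfc : ∀ x, |f x| ≤ c * W x) (n : ℕ) (x : X) : Integrable f ((κ ^ n) x) :=
  ((h.integrable_weight_pow n x).const_mul c).mono' hf.aestronglyMeasurable
    (Eventually.of_forall hfc)

lemma integral_centered_pow (h : GeomErgodic κ π W C ρ) (hf : Measurable f)
    (hfc : ∀ x, |f x| ≤ c * W x) (m n : ℕ) (x : X) :
    ∫ y, centered κ π n f y ∂((κ ^ m) x) = centered κ π (m + n) f x := by
  have := isMarkovKernel_pow κ n
  have := isMarkovKernel_pow κ m
  have h1 : κ ^ (m + n) = (κ ^ n) ∘ₖ (κ ^ m) := by rw [add_comm, Kernel.pow_add]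
  have h2 : Integrable f (((κ ^ n) ∘ₖ (κ ^ m)) x) := by
    rw [← h1]; exact h.integrable_pow_of_le hf hfc _ x
  simp only [centered]
  rw [h1, Kernel.integral_comp h2, integral_sub h2.integral_comp (integrable_const _)]
  simp

lemma integral_centered (h : GeomErgodic κ π W C ρ) (hf : Measurable f)
    (hfc : ∀ x, |f x| ≤ c * W x) (n : ℕ) : ∫ y, centered κ π n f y ∂π = 0 := by
  obtain ⟨x⟩ : Nonempty X := nonempty_of_isProbabilityMeasure π
  have := isMarkovKernel_pow κ n
  have h1 : ((κ ^ n) ∘ₖ Kernel.const X π) x = π := by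
    rw [(h.invariant_pow n).comp_const, Kernel.const_apply]
  have h2 : Integrable f (((κ ^ n) ∘ₖ Kernel.const X π) x) := by
    rw [h1]; exact h.integrable_of_le hf hfc
  have h3 := Kernel.integral_comp h2
  have h4 := h2.integral_comp
  rw [h1] at h3
  rw [Kernel.const_apply] at h3 h4
  simp only [centered]
  rw [integral_sub h4 (integrable_const _), ← h3]
  simp

/-- From the first iterate on, the functions have π-mean zero, so subtracting π again changes
nothing. The zeroth iterate is f itself, uncentred, which is why the index starts at 1. -/
lemma iterate_pbar_succ (h : GeomErgodic κ π W C ρ) (hf : Measurable f)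
    (hfc : ∀ x, |f x| ≤ c * W x) (n : ℕ) :
    (pbar κ π)^[n + 1] f = centered κ π (n + 1) f := by
  induction n with
  | zero => funext x; simp [pbar, centered]
  | succ n ih =>
    rw [Function.iterate_succ_apply', ih]
    funext x
    have h1 := h.integral_centered_pow hf hfc 1 (n + 1) x
    rw [pow_one, add_comm 1] at h1
    rw [pbar, h1, h.integral_centered hf hfc, sub_zero]

lemma integral_poissonSol (h : GeomErgodic κ π W C ρ) (hc : 0 < c) (hf : Measurable f)
    (hfc : ∀ x, |f x| ≤ c * W x) : ∫ y, poissonSol κ π f y ∂π = 0 := by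
  have h1 := integral_tsum_of_summable_integral_norm
    (h.integrable_centered hc hf hfc h.integrable_weight)
    (h.summable_integral_norm hc hf hfc h.integrable_weight)
  simp_rw [h.integral_centered hf hfc, tsum_zero] at h1
  exact h1.symm

lemma integrable_weight_kernel (h : GeomErgodic κ π W C ρ) (x : X) : Integrable W (κ x) := by
  simpa using h.integrable_weight_pow 1 x

/-- The Poisson equation. -/
lemma integral_poissonSol_kernel (h : GeomErgodic κ π W C ρ) (hc : 0 < c) (hf : Measurable f)
    (hfc : ∀ x, |f x| ≤ c * W x) (x : X) :
    ∫ y, poissonSol κ π f y ∂(κ x) = poissonSol κ π f x - (f x - ∫ y, f y ∂π) := by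
  have h1 := integral_tsum_of_summable_integral_norm
    (h.integrable_centered hc hf hfc (h.integrable_weight_kernel x))
    (h.summable_integral_norm hc hf hfc (h.integrable_weight_kernel x))
  have h2 : ∀ n, ∫ y, centered κ π n f y ∂(κ x) = centered κ π (n + 1) f x := fun n => by
    have := h.integral_centered_pow hf hfc 1 n x
    rwa [pow_one, add_comm] at this
  simp_rw [h2] at h1
  have h3 := (h.summable_centered hc hf hfc x).tsum_eq_zero_add
  rw [centered_zero hf] at h3
  simp only [poissonSol]
  rw [← h1, h3]
  ring

lemma summable_iterate_pbar (h : GeomErgodic κ π W C ρ) (hc : 0 < c) (hf : Measurable f)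
    (hfc : ∀ x, |f x| ≤ c * W x) (x : X) : Summable fun n => ((pbar κ π)^[n] f) x := by
  rw [← summable_nat_add_iff 1]
  simp_rw [h.iterate_pbar_succ hf hfc]
  exact (summable_nat_add_iff 1).2 (h.summable_centered hc hf hfc x)

/-- The two series differ only in their zeroth terms. The resulting constant cancels in G, so
`poissonSol`, which has π-mean zero, can replace the resolvent. -/
lemma resolvent_eq (h : GeomErgodic κ π W C ρ) (hc : 0 < c) (hf : Measurable f)
    (hfc : ∀ x, |f x| ≤ c * W x) (x : X) :
    resolvent κ π f x = poissonSol κ π f x + ∫ y, f y ∂π := by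
  rw [resolvent, poissonSol, (h.summable_iterate_pbar hc hf hfc x).tsum_eq_zero_add,
    (h.summable_centered hc hf hfc x).tsum_eq_zero_add, centered_zero hf]
  simp_rw [h.iterate_pbar_succ hf hfc]
  simp only [Function.iterate_zero, id]
  ring

lemma integrable_resolvent (h : GeomErgodic κ π W C ρ) (hc : 0 < c) (hf : Measurable f)
    (hfc : ∀ x, |f x| ≤ c * W x) (x : X) : Integrable (resolvent κ π f) (κ x) := by
  rw [show resolvent κ π f = fun x => poissonSol κ π f x + ∫ y, f y ∂π from
    funext (h.resolvent_eq hc hf hfc)]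
  exact (h.integrable_poissonSol hc hf hfc (h.integrable_weight_kernel x)).add
    (integrable_const _)

lemma bigG_eq (h : GeomErgodic κ π W C ρ) (hc : 0 < c) (hf : Measurable f)
    (hfc : ∀ x, |f x| ≤ c * W x) (x y : X) :
    bigG κ π f x y = poissonSol κ π f y - ∫ z, poissonSol κ π f z ∂(κ x) := by
  rw [bigG, show resolvent κ π f = fun x => poissonSol κ π f x + ∫ y, f y ∂π from
    funext (h.resolvent_eq hc hf hfc), integral_add
    (h.integrable_poissonSol hc hf hfc (h.integrable_weight_kernel x)) (integrable_const _)]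
  simp

/-- A function `u` with `π(u) = 0` is controlled by `u - κ u`. -/
lemma abs_le_of_sub_kernel_le (h : GeomErgodic κ π W C ρ) {u r : X → ℝ} (hu : Measurable u)
    {a K : ℝ} (ha : 0 < a) (hua : ∀ x, |u x| ≤ a * W x) (hπ : ∫ y, u y ∂π = 0)
    (hr : ∀ x, r x = u x - ∫ y, u y ∂(κ x)) (hK : 0 < K) (hrK : ∀ x, |r x| ≤ K * W x) (x : X) :
    |u x| ≤ K * C / (1 - ρ) * W x := by
  have hC := h.C_pos
  have hρ := h.ρ_pos
  have hρ1 : 0 < 1 - ρ := by linarith [h.ρ_lt_one]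
  have hW := h.W_nonneg x
  have hr' : r = fun x => centered κ π 0 u x - centered κ π 1 u x := by
    funext x
    rw [hr, centered_zero hu, centered, pow_one]
    ring
  have hrm : Measurable r := by
    rw [hr']; exact (measurable_centered hu 0).sub (measurable_centered hu 1)
  have hstep : ∀ n, centered κ π n r x = centered κ π n u x - centered κ π (n + 1) u x := by
    intro n
    have hn := isMarkovKernel_pow κ n
    have hν := h.integrable_weight_pow n x
    rw [centered, hr', integral_sub (h.integrable_centered ha hu hua hν 0)
      (h.integrable_centered ha hu hua hν 1), integral_sub
      (h.integrable_centered ha hu hua h.integrable_weight 0)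
      (h.integrable_centered ha hu hua h.integrable_weight 1),
      h.integral_centered_pow hu hua, h.integral_centered_pow hu hua, h.integral_centered hu hua,
      h.integral_centered hu hua, add_zero]
    ring
  -- Iterating u = r + κu; the remainder decays geometrically because π(u) = 0.
  have htel : ∀ n, u x = ∑ i ∈ Finset.range n, centered κ π i r x + centered κ π n u x := by
    intro n
    simp_rw [hstep]
    rw [Finset.sum_range_sub', centered_zero hu, hπ]
    ring
  have hlim : Tendsto (fun n : ℕ => K * C / (1 - ρ) * W x + a * C * ρ ^ n * W x) atTop
      (𝓝 (K * C / (1 - ρ) * W x + a * C * 0 * W x)) :=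
    (((tendsto_pow_atTop_nhds_zero_of_lt_one hρ.le h.ρ_lt_one).const_mul _).mul_const _).const_add _
  rw [mul_zero, zero_mul, add_zero] at hlim
  refine ge_of_tendsto' hlim fun n => ?_
  have hg : ∑ i ∈ Finset.range n, ρ ^ i ≤ (1 - ρ)⁻¹ := by
    rw [← tsum_geometric_of_lt_one hρ.le h.ρ_lt_one]
    exact (summable_geometric_of_lt_one hρ.le h.ρ_lt_one).sum_le_tsum _ fun i _ => by positivity
  calc |u x| ≤ |∑ i ∈ Finset.range n, centered κ π i r x| + |centered κ π n u x| := by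
        conv_lhs => rw [htel n]
        exact abs_add_le _ _
    _ ≤ ∑ i ∈ Finset.range n, K * C * ρ ^ i * W x + a * C * ρ ^ n * W x := by
        refine add_le_add ((Finset.abs_sum_le_sum_abs _ _).trans (Finset.sum_le_sum fun i _ => ?_))
          (h.abs_centered_le ha hu hua n x)
        exact h.abs_centered_le hK hrm hrK i x
    _ = K * C * (∑ i ∈ Finset.range n, ρ ^ i) * W x + a * C * ρ ^ n * W x := by
        rw [Finset.mul_sum, Finset.sum_mul]
    _ ≤ _ := by
        rw [div_eq_mul_inv]
        gcongr

end GeomErgodic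

/-! ### Families of kernels -/

section Family

variable {X Θ : Type*} [MeasurableSpace X] [MeasurableSpace Θ] {P : Θ → Kernel X X}

/-- The kernel `(t, x) ↦ P_t(x, ·)`. -/
noncomputable def jointKernel (P : Θ → Kernel X X)
    (hP : ∀ A : Set X, MeasurableSet A → Measurable fun p : Θ × X => P p.1 p.2 A) :
    Kernel (Θ × X) X :=
  ⟨fun p => P p.1 p.2, Measure.measurable_of_measurable_coe _ hP⟩

instance isMarkovKernel_jointKernel [∀ t, IsMarkovKernel (P t)]
    (hP : ∀ A : Set X, MeasurableSet A → Measurable fun p : Θ × X => P p.1 p.2 A) :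
    IsMarkovKernel (jointKernel P hP) :=
  ⟨fun p => inferInstanceAs (IsProbabilityMeasure (P p.1 p.2))⟩

variable [∀ t, IsMarkovKernel (P t)] {π : Measure X} [IsProbabilityMeasure π] {W h : X → ℝ}
  {C ρ c : ℝ}

/-- Joint measurability is assumed for one step only. Each further power is obtained by integrating
against `jointKernel`, with the parameter held fixed. -/
lemma measurable_centered_joint
    (hP : ∀ A : Set X, MeasurableSet A → Measurable fun p : Θ × X => P p.1 p.2 A)
    (hG : ∀ t, GeomErgodic (P t) π W C ρ) (hh : Measurable h) (hhc : ∀ x, |h x| ≤ c * W x)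
    (n : ℕ) : Measurable fun p : Θ × X => centered (P p.1) π n h p.2 := by
  induction n with
  | zero =>
    simp_rw [GeomErgodic.centered_zero hh]
    exact (hh.comp measurable_snd).sub_const _
  | succ n ih =>
    have h1 : ∀ p : Θ × X, centered (P p.1) π (n + 1) h p.2 =
        ∫ y, centered (P p.1) π n h y ∂(jointKernel P hP p) := fun p => by
      have := (hG p.1).integral_centered_pow hh hhc 1 n p.2
      rw [pow_one, add_comm] at this
      exact this.symm
    simp_rw [h1]
    have h2 : StronglyMeasurable fun q : (Θ × X) × X => centered (P q.1.1) π n h q.2 :=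
      (ih.comp ((measurable_fst.comp measurable_fst).prodMk measurable_snd)).stronglyMeasurable
    exact (h2.integral_kernel_prod_right' (κ := jointKernel P hP)).measurable

lemma measurable_poissonSol_joint
    (hP : ∀ A : Set X, MeasurableSet A → Measurable fun p : Θ × X => P p.1 p.2 A)
    (hG : ∀ t, GeomErgodic (P t) π W C ρ) (hc : 0 < c) (hh : Measurable h)
    (hhc : ∀ x, |h x| ≤ c * W x) : Measurable fun p : Θ × X => poissonSol (P p.1) π h p.2 := by
  refine measurable_of_tendsto_metrizable (f := fun n (p : Θ × X) => ∑ i ∈ Finset.range n,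
    centered (P p.1) π i h p.2) (fun n => Finset.measurable_sum _ fun i _ =>
      measurable_centered_joint hP hG hh hhc i) ?_
  exact tendsto_pi_nhds.2 fun p =>
    ((hG p.1).summable_centered hc hh hhc p.2).hasSum.tendsto_sum_nat

/-- The Poisson equation removes the integral. -/
lemma measurable_integral_poissonSol_joint
    (hP : ∀ A : Set X, MeasurableSet A → Measurable fun p : Θ × X => P p.1 p.2 A)
    (hG : ∀ t, GeomErgodic (P t) π W C ρ) (hc : 0 < c) (hh : Measurable h)
    (hhc : ∀ x, |h x| ≤ c * W x) :
    Measurable fun p : Θ × X => ∫ y, poissonSol (P p.1) π h y ∂(P p.1 p.2) := by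
  have h1 : ∀ p : Θ × X, ∫ y, poissonSol (P p.1) π h y ∂(P p.1 p.2) =
      poissonSol (P p.1) π h p.2 - (h p.2 - ∫ y, h y ∂π) := fun p =>
    (hG p.1).integral_poissonSol_kernel hc hh hhc p.2
  simp_rw [h1]
  exact (measurable_poissonSol_joint hP hG hc hh hhc).sub ((hh.comp measurable_snd).sub_const _)

end Family

/-! ### Lipschitz dependence of the Poisson solution on the parameter -/

section Parameter

variable {X Θ : Type*} [MeasurableSpace X] {P : Θ → Kernel X X} {π : Measure X} {h : X → ℝ}
  {C ρ c : ℝ}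

lemma abs_integral_sub_integral_le {V : X → ℝ} (hV : ∀ x, 1 ≤ V x) {β K : ℝ} (hβ : 0 ≤ β)
    (hK : 0 ≤ K) {t t' : Θ} (hD : kerDist P V β t t' ≤ ENNReal.ofReal K) {a : ℝ} (ha : 0 < a)
    {f : X → ℝ} (hf : Measurable f) (hfa : ∀ x, |f x| ≤ a * V x ^ β) (x : X) :
    |∫ y, f y ∂(P t x) - ∫ y, f y ∂(P t' x)| ≤ a * K * V x ^ β := by
  have hVx : ∀ x, 1 ≤ V x ^ β := fun x => Real.one_le_rpow (hV x) hβ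
  have h1 : ENNReal.ofReal (|∫ y, a⁻¹ * f y ∂(P t x) - ∫ y, a⁻¹ * f y ∂(P t' x)| / V x ^ β) ≤
      kerDist P V β t t' :=
    le_iSup_of_le (fun y => a⁻¹ * f y) (le_iSup_of_le (hf.const_mul _)
      (le_iSup_of_le (wNorm_le_one hVx fun x => by
        rw [abs_mul, abs_of_pos (inv_pos.2 ha), inv_mul_le_iff₀ ha]; exact hfa x)
        (le_iSup_of_le x le_rfl)))
  have h2 := (ENNReal.ofReal_le_ofReal_iff hK).1 (h1.trans hD)
  rw [integral_const_mul, integral_const_mul, ← mul_sub, abs_mul, abs_of_pos (inv_pos.2 ha),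
    div_le_iff₀ (by linarith [hVx x]), inv_mul_le_iff₀ ha] at h2
  linarith

variable [∀ t, IsMarkovKernel (P t)] [IsProbabilityMeasure π]

/-- The solutions of the Poisson equations depend on the parameter in a Lipschitz way. -/
lemma abs_poissonSol_sub_le {V : X → ℝ} (hV : ∀ x, 1 ≤ V x) {β K : ℝ} (hβ : 0 ≤ β)
    (hG : ∀ t, GeomErgodic (P t) π (fun x => V x ^ β) C ρ) (hc : 0 < c) (hh : Measurable h)
    (hhc : ∀ x, |h x| ≤ c * V x ^ β) (hK : 0 < K) {t t' : Θ}
    (hD : kerDist P V β t t' ≤ ENNReal.ofReal K) (x : X) :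
    |poissonSol (P t) π h x - poissonSol (P t') π h x| ≤
      c * C / (1 - ρ) * K * C / (1 - ρ) * V x ^ β := by
  have hC := (hG t).C_pos
  have hρ : 0 < 1 - ρ := by linarith [(hG t).ρ_lt_one]
  have ha : 0 < c * C / (1 - ρ) := by positivity
  have hm : ∀ t, Measurable (poissonSol (P t) π h) := fun t =>
    GeomErgodic.measurable_poissonSol hh ((hG t).summable_centered hc hh hhc)
  have hint : ∀ t x, Integrable (poissonSol (P t) π h) (P t' x) := fun t x =>
    (hG t).integrable_poissonSol hc hh hhc ((hG t').integrable_weight_kernel x)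
  have hint' : ∀ s x, Integrable (poissonSol (P s) π h) (P t x) := fun s x =>
    (hG s).integrable_poissonSol hc hh hhc ((hG t).integrable_weight_kernel x)
  have hπ : ∀ t, Integrable (poissonSol (P t) π h) π := fun t =>
    (hG t).integrable_poissonSol hc hh hhc (hG t).integrable_weight
  -- For u = g_t - g_{t'} the two Poisson equations give u - P_t u = (P_t - P_{t'}) g_{t'}, which
  -- the kernel distance bounds.
  refine (hG t).abs_le_of_sub_kernel_le
    (u := fun x => poissonSol (P t) π h x - poissonSol (P t') π h x)
    (r := fun x => ∫ y, poissonSol (P t') π h y ∂(P t x) - ∫ y, poissonSol (P t') π h y ∂(P t' x))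
    ((hm t).sub (hm t')) (a := 2 * (c * C / (1 - ρ))) (by positivity) (fun x => ?_) ?_
    (fun x => ?_) (by positivity)
    (fun x => abs_integral_sub_integral_le hV hβ hK.le hD ha (hm t')
      ((hG t').abs_poissonSol_le hc hh hhc) x) x
  · have h1 := (hG t).abs_poissonSol_le hc hh hhc x
    have h2 := (hG t').abs_poissonSol_le hc hh hhc x
    refine (abs_sub _ _).trans ?_
    linarith
  · rw [integral_sub (hπ t) (hπ t'), (hG t).integral_poissonSol hc hh hhc,
      (hG t').integral_poissonSol hc hh hhc, sub_zero]
  · rw [integral_sub (hint' t x) (hint' t' x), (hG t).integral_poissonSol_kernel hc hh hhc,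
      (hG t').integral_poissonSol_kernel hc hh hhc]
    ring

end Parameter

/-! ### Adaptive chains -/

section Chain

variable {Ω X Θ : Type*} [MeasurableSpace X] [MeasurableSpace Θ]

lemma natFiltration_mono (ξ : ℕ → Ω → X) (θ : ℕ → Ω → Θ) : Monotone (natFiltration ξ θ) :=
  fun _ _ hmn => iSup₂_le fun k hk => le_iSup₂_of_le k (hk.trans hmn) le_rfl

lemma measurable_natFiltration (ξ : ℕ → Ω → X) (θ : ℕ → Ω → Θ) {k n : ℕ} (hk : k ≤ n) :
    Measurable[natFiltration ξ θ n] fun ω => (ξ k ω, θ k ω) :=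
  Measurable.mono (comap_measurable _) (le_iSup₂_of_le k hk le_rfl) le_rfl

variable [mΩ : MeasurableSpace Ω] {ξ : ℕ → Ω → X} {θ : ℕ → Ω → Θ} {μ : Measure Ω}
  {μ₀ : Measure (X × Θ)} {P : Θ → Kernel X X}

lemma IsAdaptiveChain.natFiltration_le (hch : IsAdaptiveChain μ μ₀ P ξ θ) (n : ℕ) :
    natFiltration ξ θ n ≤ mΩ :=
  iSup₂_le fun k _ => ((hch.measurable_state k).prodMk (hch.measurable_param k)).comap_le

variable [IsProbabilityMeasure μ]

/-- Any M ≥ b/(1 - λ) is preserved by M ↦ λM + b, whatever the adaptation. The initial moment is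
added to start the induction and 1 to have M ≥ 1. -/
lemma IsAdaptiveChain.exists_moment_bound {π : Measure X} {V : X → ℝ}
    (hch : IsAdaptiveChain μ μ₀ P ξ θ) (hA1 : AssumptionA1 P π μ₀ V) :
    ∃ M : ℝ, 1 ≤ M ∧ ∀ n, ∫⁻ ω, ENNReal.ofReal (V (ξ n ω)) ∂μ ≤ ENNReal.ofReal M := by
  obtain ⟨b, lam, hb, hl0, hl1, hdr⟩ := hA1.drift
  have hV := hA1.measurable_V
  have hV0 : ∀ x, 0 ≤ V x := fun x => zero_le_one.trans (hA1.one_le_V x)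
  have hl : 0 < 1 - lam := by linarith
  set M₀ := ∫ p, V p.1 ∂μ₀ with hM₀
  have hM₀0 : 0 ≤ M₀ := integral_nonneg fun p => hV0 _
  refine ⟨1 + M₀ + b / (1 - lam), by have : 0 < b / (1 - lam) := by positivity
                                     linarith, fun n => ?_⟩
  induction n with
  | zero =>
    have h1 : ∫⁻ ω, ENNReal.ofReal (V (ξ 0 ω)) ∂μ = ENNReal.ofReal M₀ := by
      rw [hM₀, ofReal_integral_eq_lintegral_ofReal hA1.integrable_V
        (Eventually.of_forall fun p => hV0 _), ← hch.initial, lintegral_map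
        (f := fun p : X × Θ => ENNReal.ofReal (V p.1)) (hV.comp measurable_fst).ennreal_ofReal
        ((hch.measurable_state 0).prodMk (hch.measurable_param 0))]
    rw [h1]
    have : 0 < b / (1 - lam) := by positivity
    exact ENNReal.ofReal_le_ofReal (by linarith)
  | succ n ih =>
    have hpos : 0 < b / (1 - lam) := by positivity
    calc ∫⁻ ω, ENNReal.ofReal (V (ξ (n + 1) ω)) ∂μ
        = ∫⁻ ω, ∫⁻ y, ENNReal.ofReal (V y) ∂(P (θ n ω) (ξ n ω)) ∂μ := by
          rw [← lintegral_condLExp (hch.natFiltration_le n) μ fun ω => ENNReal.ofReal (V (ξ (n + 1) ω))]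
          exact lintegral_congr_ae (hch.transition n (fun y => ENNReal.ofReal (V y))
            hV.ennreal_ofReal)
      _ ≤ ∫⁻ ω, (ENNReal.ofReal lam * ENNReal.ofReal (V (ξ n ω)) + ENNReal.ofReal b) ∂μ := by
          refine lintegral_mono fun ω => (hdr _ _).trans (le_of_eq ?_)
          have := hV0 (ξ n ω)
          rw [ENNReal.ofReal_add (by positivity) hb.le, ENNReal.ofReal_mul hl0.le]
      _ = ENNReal.ofReal lam * ∫⁻ ω, ENNReal.ofReal (V (ξ n ω)) ∂μ + ENNReal.ofReal b := by
          rw [lintegral_add_right _ measurable_const, lintegral_const_mul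
            (f := fun ω => ENNReal.ofReal (V (ξ n ω))) _ (hV.comp (hch.measurable_state n)).ennreal_ofReal]
          simp
      _ ≤ ENNReal.ofReal lam * ENNReal.ofReal (1 + M₀ + b / (1 - lam)) + ENNReal.ofReal b := by
          gcongr
      _ = ENNReal.ofReal (lam * (1 + M₀ + b / (1 - lam)) + b) := by
          rw [ENNReal.ofReal_add (by positivity) hb.le, ENNReal.ofReal_mul hl0.le]
      _ ≤ _ := by
          refine ENNReal.ofReal_le_ofReal ?_
          have : b = (1 - lam) * (b / (1 - lam)) := by field_simp
          nlinarith

variable [∀ t, IsMarkovKernel (P t)]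

/-- The joint law of the past and the next state. -/
lemma IsAdaptiveChain.map_prodMk (hch : IsAdaptiveChain μ μ₀ P ξ θ)
    (hP : ∀ A : Set X, MeasurableSet A → Measurable fun p : Θ × X => P p.1 p.2 A) {n : ℕ}
    {Z : Ω → ℝ} (hZ : Measurable[natFiltration ξ θ n] Z) :
    μ.map (fun ω => ((Z ω, (θ n ω, ξ n ω)), ξ (n + 1) ω)) =
      (μ.map fun ω => (Z ω, (θ n ω, ξ n ω))) ⊗ₘ
        ((jointKernel P hP).comap Prod.snd measurable_snd) := by
  have hle := hch.natFiltration_le n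
  have hQF : Measurable[natFiltration ξ θ n] fun ω => (Z ω, (θ n ω, ξ n ω)) :=
    Measurable.prodMk hZ (measurable_swap.comp (measurable_natFiltration ξ θ le_rfl))
  have hQ : Measurable fun ω => (Z ω, (θ n ω, ξ n ω)) := hQF.mono hle le_rfl
  have hX := hch.measurable_state (n + 1)
  have : IsProbabilityMeasure (μ.map fun ω => (Z ω, (θ n ω, ξ n ω))) :=
    Measure.isProbabilityMeasure_map hQ.aemeasurable
  have : IsProbabilityMeasure (μ.map fun ω => ((Z ω, (θ n ω, ξ n ω)), ξ (n + 1) ω)) :=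
    Measure.isProbabilityMeasure_map (hQ.prodMk hX).aemeasurable
  -- Rectangles suffice: s pulls back to an event of the past, and on it the transition property is
  -- applied to the indicator of t.
  refine Measure.ext_prod fun {s t} hs ht => ?_
  rw [Measure.map_apply (hQ.prodMk hX) (hs.prod ht), Measure.compProd_apply_prod hs ht,
    setLIntegral_map hs (Kernel.measurable_coe _ ht) hQ]
  have hS : MeasurableSet[natFiltration ξ θ n] ((fun ω => (Z ω, (θ n ω, ξ n ω))) ⁻¹' s) := hQF hs
  have htr := hch.transition n (t.indicator fun _ => 1) (measurable_const.indicator ht)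
  have h1 := setLIntegral_condLExp hle μ (fun ω => t.indicator (fun _ => (1 : ℝ≥0∞)) (ξ (n + 1) ω))
    hS
  rw [setLIntegral_congr_fun_ae (hle _ hS) (htr.mono fun ω hω _ => hω)] at h1
  have h2 : ∀ ω, ∫⁻ y, t.indicator (fun _ => (1 : ℝ≥0∞)) y ∂(P (θ n ω) (ξ n ω)) =
      P (θ n ω) (ξ n ω) t := fun ω => by rw [lintegral_indicator_const ht, one_mul]
  simp_rw [h2] at h1
  change _ = ∫⁻ ω in _, P (θ n ω) (ξ n ω) t ∂μ
  rw [h1]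
  have h3 : (fun ω => t.indicator (fun _ => (1 : ℝ≥0∞)) (ξ (n + 1) ω)) =
      (ξ (n + 1) ⁻¹' t).indicator fun _ => 1 := rfl
  rw [h3, lintegral_indicator_const (hX ht), one_mul, Measure.restrict_apply (hX ht),
    Set.inter_comm]
  rfl

/-- The function `g_{θ_j}(X_{j+1}) - q_{θ_j}(X_j)`, at time `j + 1`, and `0` at time `0`. -/
def transitionIncrement (g q : Θ → X → ℝ) (ξ : ℕ → Ω → X) (θ : ℕ → Ω → Θ) : ℕ → Ω → ℝ
  | 0 => fun _ => 0
  | j + 1 => fun ω => g (θ j ω) (ξ (j + 1) ω) - q (θ j ω) (ξ j ω)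

/-- Keeping Z in the joint law with (θ_j, X_j) reduces orthogonality to Fubini: the inner integral
over X_{j+1} is zero. Only integrability of the product is needed, so Z may be unbounded. -/
lemma IsAdaptiveChain.isMartingaleDiff (hch : IsAdaptiveChain μ μ₀ P ξ θ)
    (hP : ∀ A : Set X, MeasurableSet A → Measurable fun p : Θ × X => P p.1 p.2 A)
    {g : Θ → X → ℝ} (hg : Measurable fun p : Θ × X => g p.1 p.2)
    (hq : Measurable fun p : Θ × X => ∫ y, g p.1 y ∂(P p.1 p.2))
    (hgi : ∀ t x, Integrable (g t) (P t x)) :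
    IsMartingaleDiff (natFiltration ξ θ) μ
      (transitionIncrement g (fun t x => ∫ y, g t y ∂(P t x)) ξ θ) := by
  refine ⟨fun j => ?_, fun j Z hZ hint => ?_⟩
  · cases j with
    | zero => exact measurable_const
    | succ j =>
      have hj := measurable_natFiltration ξ θ (Nat.le_add_right j 1)
      have hj1 := measurable_natFiltration ξ θ (le_refl (j + 1))
      have h1 : Measurable[natFiltration ξ θ (j + 1)] fun ω => (θ j ω, ξ (j + 1) ω) :=
        Measurable.prodMk (measurable_snd.comp hj) (measurable_fst.comp hj1)
      have h2 : Measurable[natFiltration ξ θ (j + 1)] fun ω => (θ j ω, ξ j ω) :=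
        measurable_swap.comp hj
      exact Measurable.sub (hg.comp h1) (hq.comp h2)
  · have hQ : Measurable fun ω => (Z ω, (θ j ω, ξ j ω)) :=
      (hZ.mono (hch.natFiltration_le j) le_rfl).prodMk
        ((hch.measurable_param j).prodMk (hch.measurable_state j))
    have hQX := hQ.prodMk (hch.measurable_state (j + 1))
    set Φ : (ℝ × (Θ × X)) × X → ℝ := fun p =>
      p.1.1 * (g p.1.2.1 p.2 - ∫ y, g p.1.2.1 y ∂(P p.1.2.1 p.1.2.2)) with hΦ
    have hΦm : Measurable Φ := by
      refine Measurable.mul (by fun_prop) (Measurable.sub (hg.comp (by fun_prop : Measurable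
        fun p : (ℝ × (Θ × X)) × X => (p.1.2.1, p.2))) (hq.comp (by fun_prop : Measurable
        fun p : (ℝ × (Θ × X)) × X => (p.1.2.1, p.1.2.2))))
    have : IsProbabilityMeasure (μ.map fun ω => (Z ω, (θ j ω, ξ j ω))) :=
      Measure.isProbabilityMeasure_map hQ.aemeasurable
    have h1 : ∫ ω, Z ω * transitionIncrement g (fun t x => ∫ y, g t y ∂(P t x)) ξ θ (j + 1) ω ∂μ =
        ∫ p, Φ p ∂(μ.map (fun ω => ((Z ω, (θ j ω, ξ j ω)), ξ (j + 1) ω))) := by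
      rw [integral_map hQX.aemeasurable hΦm.aestronglyMeasurable]; rfl
    have h2 : Integrable Φ (μ.map (fun ω => ((Z ω, (θ j ω, ξ j ω)), ξ (j + 1) ω))) :=
      (integrable_map_measure hΦm.aestronglyMeasurable hQX.aemeasurable).2 hint
    rw [h1]
    rw [hch.map_prodMk hP hZ] at h2 ⊢
    rw [Measure.integral_compProd h2]
    refine integral_eq_zero_of_ae (Eventually.of_forall fun p => ?_)
    change ∫ y, p.1 * (g p.2.1 y - ∫ y, g p.2.1 y ∂(P p.2.1 p.2.2)) ∂(P p.2.1 p.2.2) = 0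
    rw [integral_const_mul, integral_sub (hgi _ _) (integrable_const _)]
    simp

end Chain

/-! ### Fourth moments and the martingale approximation of the adaptive chain -/

/-- Since v ≥ 1 and 4s ≤ 1, the fourth power is at most c⁴ v. The factor M in place of its fourth
root is harmless because M ≥ 1. -/
lemma normLE_four_of_le {Ω : Type*} [MeasurableSpace Ω] {μ : Measure Ω} {v f : Ω → ℝ}
    (hv : ∀ ω, 1 ≤ v ω) {M : ℝ} (hM : 1 ≤ M)
    (hvM : ∫⁻ ω, ENNReal.ofReal (v ω) ∂μ ≤ ENNReal.ofReal M) (hf : Measurable f) {c s : ℝ}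
    (hc : 0 ≤ c) (hs : 4 * s ≤ 1) (hfc : ∀ᵐ ω ∂μ, |f ω| ≤ c * v ω ^ s) :
    NormLE μ 4 f (c * M) := by
  refine ⟨hf, ?_⟩
  have h := eLpNorm_nnreal_pow_eq_lintegral (μ := μ) (f := f) (p := 4) (by norm_num)
  have h2 : ((4 : NNReal) : ℝ) = ((4 : ℕ) : ℝ) := by norm_num
  rw [h2, ENNReal.rpow_natCast] at h
  simp only [ENNReal.rpow_natCast] at h
  rw [ENNReal.coe_ofNat] at h
  rw [← ENNReal.pow_le_pow_left_iff (n := 4) (by norm_num), h]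
  calc ∫⁻ ω, ‖f ω‖ₑ ^ 4 ∂μ ≤ ∫⁻ ω, ENNReal.ofReal (c ^ 4) * ENNReal.ofReal (v ω) ∂μ := by
        refine lintegral_mono_ae (hfc.mono fun ω hω => ?_)
        rw [Real.enorm_eq_ofReal_abs, ← ENNReal.ofReal_pow (abs_nonneg _),
          ← ENNReal.ofReal_mul (by positivity)]
        refine ENNReal.ofReal_le_ofReal ?_
        have hv0 : 0 ≤ v ω := zero_le_one.trans (hv ω)
        calc |f ω| ^ 4 ≤ (c * v ω ^ s) ^ 4 := pow_le_pow_left₀ (abs_nonneg _) hω 4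
          _ = c ^ 4 * v ω ^ (s * 4) := by
            rw [mul_pow, Real.rpow_mul hv0]; norm_num
          _ ≤ c ^ 4 * v ω ^ (1 : ℝ) := by
            gcongr
            · exact hv ω
            · linarith
          _ = _ := by rw [Real.rpow_one]
    _ = ENNReal.ofReal (c ^ 4) * ∫⁻ ω, ENNReal.ofReal (v ω) ∂μ :=
        lintegral_const_mul' _ _ ENNReal.ofReal_ne_top
    _ ≤ ENNReal.ofReal (c ^ 4) * ENNReal.ofReal M := by gcongr
    _ ≤ _ := by
        rw [← ENNReal.ofReal_mul (by positivity), ← ENNReal.ofReal_pow (by positivity), mul_pow]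
        refine ENNReal.ofReal_le_ofReal (mul_le_mul_of_nonneg_left ?_ (by positivity))
        exact le_self_pow₀ hM (by norm_num)

/-- Sample autocovariances are invariant under translation and never use index 0, so Y may be
centred by π(h) and set to zero at time 0. -/
lemma kernelEstimator_congr (w : ℝ → ℝ) (b : ℕ → ℝ) {Y Z : ℕ → ℝ} {a : ℝ}
    (h : ∀ j, 1 ≤ j → Y j = Z j - a) (n : ℕ) : kernelEstimator w b Z n = kernelEstimator w b Y n := by
  have hmean : 1 ≤ n → sampleMean Y n = sampleMean Z n - a := fun hn => by
    have hn0 : (n : ℝ) ≠ 0 := by exact_mod_cast (by omega : n ≠ 0)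
    simp only [sampleMean]
    rw [Finset.sum_congr rfl fun j hj => h j (Finset.mem_Icc.1 hj).1, Finset.sum_sub_distrib,
      mul_sub, Finset.sum_const, Nat.card_Icc, Nat.add_sub_cancel, nsmul_eq_mul]
    field_simp
  refine Finset.sum_congr rfl fun k _ => ?_
  congr 1
  simp only [sampleAutocov]
  split_ifs with hk
  · rfl
  · rw [hmean (by omega)]
    congr 1
    refine Finset.sum_congr rfl fun j hj => ?_
    have hj := (Finset.mem_Icc.1 hj).1
    rw [h j hj, h (j + k.natAbs) (by omega)]
    ring

/-- Cauchy–Schwarz. -/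
lemma sum_le_mul_sqrt_card {γ : ℕ → ℝ} (hγ : Summable fun n => γ n ^ 2)
    (s : Finset ℕ) : ∑ j ∈ s, γ j ≤ √(∑' j, γ j ^ 2) * √s.card := by
  have h1 := sq_sum_le_card_mul_sum_sq (s := s) (f := γ)
  have h2 : ∑ j ∈ s, γ j ^ 2 ≤ ∑' j, γ j ^ 2 := hγ.sum_le_tsum s fun j _ => sq_nonneg _
  rw [← Real.sqrt_mul (tsum_nonneg fun j => sq_nonneg _)]
  refine Real.le_sqrt_of_sq_le (h1.trans ?_)
  rw [mul_comm]
  exact mul_le_mul_of_nonneg_right h2 (Nat.cast_nonneg _)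

section Approximation

variable {Ω X Θ : Type*} [MeasurableSpace Ω] [MeasurableSpace X] [MeasurableSpace Θ]

/-- The values `h(X_j) - π(h)` at times `j ≥ 1`, and `0` at time `0`. -/
noncomputable def centeredValues (π : Measure X) (h : X → ℝ) (ξ : ℕ → Ω → X) : ℕ → Ω → ℝ
  | 0 => fun _ => 0
  | j + 1 => fun ω => h (ξ (j + 1) ω) - ∫ y, h y ∂π

/-- The martingale approximation of an adaptive chain given by the Poisson equation. -/
lemma exists_martingaleApprox {μ : Measure Ω} [IsProbabilityMeasure μ] {π : Measure X}
    [IsProbabilityMeasure π] {μ₀ : Measure (X × Θ)} {P : Θ → Kernel X X}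
    [∀ t, IsMarkovKernel (P t)]
    (hP : ∀ A : Set X, MeasurableSet A → Measurable fun p : Θ × X => P p.1 p.2 A)
    {ξ : ℕ → Ω → X} {θ : ℕ → Ω → Θ} (hch : IsAdaptiveChain μ μ₀ P ξ θ)
    {V : X → ℝ} (hA1 : AssumptionA1 P π μ₀ V) {η : ℝ} (hA2 : AssumptionA2 μ P V ξ θ η)
    {β : ℝ} (hβ0 : 0 < β) (hβ1 : β < 1 / 4 - η) {C ρ c : ℝ}
    (hG : ∀ t, GeomErgodic (P t) π (fun x => V x ^ β) C ρ) (hc : 0 < c) {h : X → ℝ}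
    (hh : Measurable h) (hhc : ∀ x, |h x| ≤ c * V x ^ β) :
    ∃ (U R : ℕ → Ω → ℝ) (A : ℝ) (r : ℕ → ℝ), MartingaleApprox (natFiltration ξ θ) μ
      (transitionIncrement (fun t => poissonSol (P t) π h)
        (fun t x => ∫ y, poissonSol (P t) π h y ∂(P t x)) ξ θ) U R (centeredValues π h ξ) A r := by
  obtain ⟨hη0, -, γ, hγ0, -, ⟨α, hα, hγα⟩, hD⟩ := hA2
  obtain ⟨K₀, hK₀⟩ := hD β hβ0.le (by linarith)
  obtain ⟨M, hM1, hM⟩ := hch.exists_moment_bound hA1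
  obtain ⟨x₀⟩ : Nonempty X := nonempty_of_isProbabilityMeasure π
  obtain ⟨t₀⟩ : Nonempty Θ := by
    obtain ⟨ω⟩ : Nonempty Ω := nonempty_of_isProbabilityMeasure μ
    exact ⟨θ 0 ω⟩
  have hC := (hG t₀).C_pos
  have hρ : 0 < 1 - ρ := by linarith [(hG t₀).ρ_lt_one]
  have hV1 := hA1.one_le_V
  have hV0 : ∀ x, 0 < V x := fun x => zero_lt_one.trans_le (hV1 x)
  set g : Θ → X → ℝ := fun t => poissonSol (P t) π h with hg
  set q : Θ → X → ℝ := fun t x => ∫ y, g t y ∂(P t x) with hq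
  have hgm : Measurable fun p : Θ × X => g p.1 p.2 := measurable_poissonSol_joint hP hG hc hh hhc
  have hqm : Measurable fun p : Θ × X => q p.1 p.2 :=
    measurable_integral_poissonSol_joint hP hG hc hh hhc
  set a := c * C / (1 - ρ) with ha
  have ha0 : 0 < a := by positivity
  have hga : ∀ t x, |g t x| ≤ a * V x ^ β := fun t => (hG t).abs_poissonSol_le hc hh hhc
  have hqa : ∀ t x, |q t x| ≤ a * C * V x ^ β := fun t x => by
    have h1 := (hG t).abs_centered_le' ha0
      (GeomErgodic.measurable_poissonSol hh ((hG t).summable_centered hc hh hhc)) (hga t) 1 x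
    rwa [centered, (hG t).integral_poissonSol hc hh hhc, sub_zero, pow_one] at h1
  have hyc : ∀ x, |h x - ∫ y, h y ∂π| ≤ c * C * V x ^ β := fun x => by
    have h1 := (hG t₀).abs_centered_le' hc hh hhc 0 x
    rwa [GeomErgodic.centered_zero hh] at h1
  have hξ := hch.measurable_state
  have hθ := hch.measurable_param
  have hnorm : ∀ (j : ℕ) (f : Ω → ℝ) (d : ℝ), Measurable f → 0 ≤ d →
      (∀ ω, |f ω| ≤ d * V (ξ j ω) ^ β) → NormLE μ 4 f (d * M) := fun j f d hf hd hfd =>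
    normLE_four_of_le (fun ω => hV1 (ξ j ω)) hM1 (hM j) hf hd (s := β) (by linarith)
      (Eventually.of_forall hfd)
  -- The constant supplied by the assumption need not be positive.
  set K := max K₀ 1 with hK
  have hK1 : 0 < K := zero_lt_one.trans_le (le_max_right _ _)
  set cR := a * K * C / (1 - ρ) with hcR
  have hcR0 : 0 < cR := by positivity
  -- Nothing is known about γ at 0, and R is not bounded there.
  set r : ℕ → ℝ := fun j => if j = 0 then 0 else cR * γ j * M with hr
  have hr0 : ∀ j, 0 ≤ r j := fun j => by
    simp only [hr]
    split_ifs with hj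
    · exact le_rfl
    · have := hγ0 j (by omega); positivity
  -- This is where α > 1/2 enters.
  have hrs : Summable fun j => r j ^ 2 := by
    refine summable_of_isBigO_nat (g := fun n : ℕ => (n : ℝ) ^ (-α * 2))
      (Real.summable_nat_rpow.2 (by linarith)) ?_
    have h1 : (fun n : ℕ => ((cR * M) * γ n) ^ 2) =O[atTop] fun n : ℕ => (n : ℝ) ^ (-α * 2) := by
      refine ((hγα.const_mul_left (cR * M)).pow 2).congr_right fun n => ?_
      rw [Real.rpow_mul (Nat.cast_nonneg n)]
      norm_num
    refine h1.congr' ?_ EventuallyEq.rfl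
    filter_upwards [eventually_ge_atTop 1] with n hn
    simp only [hr]
    rw [if_neg (by omega)]
    ring
  set S := √(∑' j, r j ^ 2) with hS
  have hMpos : 0 < M := zero_lt_one.trans_le hM1
  have e1 : 0 ≤ a * M := by positivity
  have e2 : 0 ≤ a * C * M := by positivity
  have e3 : 0 ≤ c * C * M := by positivity
  have e4 : 0 ≤ S := Real.sqrt_nonneg _
  refine ⟨fun j ω => q (θ j ω) (ξ j ω),
    fun j ω => g (θ j ω) (ξ j ω) - g (θ (j - 1) ω) (ξ j ω),
    a * M + a * C * M + c * C * M + S, r, ?_⟩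
  refine
    { mono := natFiltration_mono ξ θ
      le := hch.natFiltration_le
      diff := hch.isMartingaleDiff hP hgm hqm fun t x =>
        (hG t).integrable_poissonSol hc hh hhc ((hG t).integrable_weight_kernel x)
      adapted_U := fun j =>
        hqm.comp (measurable_swap.comp (measurable_natFiltration ξ θ le_rfl))
      adapted_Y := fun j => ?_
      Y_zero := fun ω => rfl
      Y_succ := fun j ω => ?_
      norm_D := fun j => ?_
      norm_U := fun j => ?_
      norm_Y := fun j => ?_
      norm_R := fun j hj => ?_
      ρ_nonneg := hr0
      sum_ρ := fun s => ?_ }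
  · cases j with
    | zero => exact measurable_const
    | succ j =>
      have h1 : Measurable[natFiltration ξ θ (j + 1)] (ξ (j + 1)) :=
        measurable_fst.comp (measurable_natFiltration ξ θ le_rfl)
      exact Measurable.sub_const (hh.comp h1) _
  -- The Poisson equation is used at the new parameter θ_{j+1}, while D uses θ_j; the mismatch is
  -- exactly R.
  · have h1 := (hG (θ (j + 1) ω)).integral_poissonSol_kernel hc hh hhc (ξ (j + 1) ω)
    simp only [centeredValues, transitionIncrement, hq, hg, Nat.add_sub_cancel]
    rw [h1]
    ring
  · cases j with
    | zero => exact NormLE.zero μ 4 _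
    | succ j =>
      refine ((hnorm (j + 1) (fun ω => g (θ j ω) (ξ (j + 1) ω)) a
        (hgm.comp ((hθ j).prodMk (hξ (j + 1)))) ha0.le fun ω => hga _ _).sub (by norm_num) e1 e2
        (hnorm j (fun ω => q (θ j ω) (ξ j ω)) (a * C) (hqm.comp ((hθ j).prodMk (hξ j)))
          (by positivity) fun ω => hqa _ _)).mono (by linarith)
  · exact (hnorm j _ (a * C) (hqm.comp ((hθ j).prodMk (hξ j)))
      (by positivity) fun ω => hqa _ _).mono (by linarith)
  · cases j with
    | zero => exact NormLE.zero μ 4 _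
    | succ j =>
      exact (hnorm (j + 1) _ (c * C) ((hh.comp (hξ (j + 1))).sub_const _) (by positivity)
        fun ω => hyc _).mono (by linarith)
  · have hγj := hγ0 j hj
    simp only [hr]
    rw [if_neg (by omega)]
    -- The weight V^η of the adaptation bound multiplies V^β, so the fourth moment requires 4(η + β)
    -- ≤ 1.
    refine normLE_four_of_le (fun ω => hV1 (ξ j ω)) hM1 (hM j)
      ((hgm.comp ((hθ j).prodMk (hξ j))).sub (hgm.comp ((hθ (j - 1)).prodMk (hξ j))))
      (by positivity) (s := η + β) (by linarith) ?_
    filter_upwards [hK₀ j hj] with ω hω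
    have hVη : 0 < V (ξ j ω) ^ η := Real.rpow_pos_of_pos (hV0 _) _
    have hle : kerDist P V β (θ (j - 1) ω) (θ j ω) ≤
        ENNReal.ofReal (K * γ j * V (ξ j ω) ^ η) := by
      refine hω.trans (ENNReal.ofReal_le_ofReal ?_)
      gcongr
      exact le_max_left _ _
    have h1 := abs_poissonSol_sub_le hV1 hβ0.le hG hc hh hhc (by positivity) hle (ξ j ω)
    rw [abs_sub_comm] at h1
    refine h1.trans (le_of_eq ?_)
    rw [Real.rpow_add (hV0 _), hcR, ha]
    ring
  · refine (sum_le_mul_sqrt_card hrs s).trans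
      (mul_le_mul_of_nonneg_right (by linarith) (Real.sqrt_nonneg _))

end Approximation

end AdaptiveMCMC

theorem theorem4p2 {Ω X Θ : Type*} [MeasurableSpace Ω] [MeasurableSpace X] [MeasurableSpace Θ]
    [MeasurableSpace.CountablyGenerated X]
    (μ : Measure Ω) [IsProbabilityMeasure μ]
    (π : Measure X) [IsProbabilityMeasure π]
    (μ₀ : Measure (X × Θ)) [IsProbabilityMeasure μ₀]
    (P : Θ → Kernel X X) [∀ t, IsMarkovKernel (P t)]
    (hP : ∀ A : Set X, MeasurableSet A → Measurable fun p : Θ × X => P p.1 p.2 A)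
    (ξ : ℕ → Ω → X) (θ : ℕ → Ω → Θ)
    (hchain : AdaptiveMCMC.IsAdaptiveChain μ μ₀ P ξ θ)
    (V : X → ℝ) (hA1 : AdaptiveMCMC.AssumptionA1 P π μ₀ V)
    (η : ℝ) (hA2 : AdaptiveMCMC.AssumptionA2 μ P V ξ θ η) (hη : η < 1 / 4)
    (w : ℝ → ℝ) (hA3 : AdaptiveMCMC.AssumptionA3 w)
    (β : ℝ) (hβ0 : 0 < β) (hβ1 : β < 1 / 4 - η)
    (h : X → ℝ) (hh : h ∈ AdaptiveMCMC.LSpace fun x => V x ^ β)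
    (δ : ℝ) (hδ0 : 2 * (β + η) < δ) (hδ1 : δ < 1 / 2)
    (b : ℕ → ℝ) (c : ℝ) (hc : 0 < c) (hb : ∀ n : ℕ, 1 ≤ n → b n = c * (n : ℝ) ^ (-δ)) :
    (∀ (t : Θ) (x : X),
      Summable (fun j : ℕ => ((AdaptiveMCMC.pbar (P t) π)^[j] h) x) ∧
      Integrable (AdaptiveMCMC.resolvent (P t) π h) (P t x)) ∧
    ∀ᵐ ω ∂μ, Tendsto
      (fun n : ℕ =>
        AdaptiveMCMC.kernelEstimator w b (fun k => h (ξ k ω)) n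
          - (n : ℝ)⁻¹ * ∑ k ∈ Finset.Icc 1 n,
              AdaptiveMCMC.bigG (P (θ (k - 1) ω)) π h (ξ (k - 1) ω) (ξ k ω) ^ 2)
      atTop (𝓝 0) := by
  obtain ⟨hη0, -⟩ := id hA2
  obtain ⟨ρ, C, hρ0, hρ1, hC, hrate⟩ := hA1.rate β hβ0 (by linarith)
  have hVβ : ∀ x, 1 ≤ V x ^ β := fun x => Real.one_le_rpow (hA1.one_le_V x) hβ0.le
  have hG : ∀ t, AdaptiveMCMC.GeomErgodic (P t) π (fun x => V x ^ β) C ρ := fun t =>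
    ⟨hA1.measurable_V.pow_const β, hVβ, hC, hρ0, hρ1, hA1.invariant t, fun x n => hrate x t n⟩
  obtain ⟨hhm, hhn⟩ := hh
  obtain ⟨a, ha, hha⟩ := AdaptiveMCMC.abs_le_of_wNorm_lt_top hVβ hhn
  refine ⟨fun t x => ⟨(hG t).summable_iterate_pbar ha hhm hha x,
    (hG t).integrable_resolvent ha hhm hha x⟩, ?_⟩
  obtain ⟨U, R, A, r, happ⟩ :=
    AdaptiveMCMC.exists_martingaleApprox hP hchain hA1 hA2 hβ0 hβ1 hG ha hhm hha
  filter_upwards [happ.tendsto_kernelEstimator hA3 hc (by linarith) hδ1 hb] with ω hω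
  refine hω.congr fun n => ?_
  -- Passage from h(X_k) to the centred values; the squared martingale differences are then the G²
  -- of the statement.
  rw [AdaptiveMCMC.kernelEstimator_congr w b (Y := fun j => AdaptiveMCMC.centeredValues π h ξ j ω)
    (Z := fun k => h (ξ k ω)) (a := ∫ y, h y ∂π)]
  · congr 2
    refine Finset.sum_congr rfl fun k hk => ?_
    obtain ⟨j, rfl⟩ : ∃ j, k = j + 1 := ⟨k - 1, by have := (Finset.mem_Icc.1 hk).1; omega⟩
    rw [(hG _).bigG_eq ha hhm hha]
    rfl
  · intro j hj
    obtain ⟨i, rfl⟩ : ∃ i, j = i + 1 := ⟨j - 1, by omega⟩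
    rfl
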